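/- A complex Hadamard matrix is a matrix $h\in M_n(\mathbb C)$, $n\ge 1$, with entries of modulus $1$ and pairwise orthogonal rows $h_1,\dots,h_n$. Two such matrices are equivalent if one is obtained from the other by permuting rows and columns and multiplying rows and columns by complex numbers of modulus $1$. A magic unitary is a square matrix of projections which are pairwise orthogonal and sum up to $1$ on each row and on each column. Let $\mathcal A_s(n)$ be the universal $*$-algebra generated by the entries $u_{ij}$ of an $n\times n$ magic unitary, with its Hopf $*$-algebra structure $\Delta(u_{ij})=\sum_k u_{ik}\otimes u_{kj}$, $\varepsilon(u_{ij})=\delta_{ij}$, $S(u_{ij})=u_{ji}$. For a complex Hadamard matrix $h$, the projections $P_{ij}\in M_n(\mathbb C)$ onto the lines spanned by the vectors $\xi_{ij}=h_j/h_i\in\mathbb C^n$ (entrywise quotient) form a magic unitary; let $\pi:\mathcal A_s(n)\to M_n(\mathbb C)$ be the representation with $\pi(u_{ij})=P_{ij}$, let $J$ be the largest Hopf $*$-ideal of $\mathcal A_s(n)$ contained in $\ker\pi$, and let $A=A(h)$, the quantum permutation algebra of $h$, be the enveloping $C^*$-algebra of $\mathcal A_s(n)/J$, generated by the images of the $u_{ij}$,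 still denoted $u_{ij}$. Then the construction $h\mapsto A(h)$ has the following properties. (1) For the Fourier matrix $h=(w^{ij})_{i,j\in\mathbb Z_n}$, $w=e^{2\pi i/n}$, we have $A=C(\mathbb Z_n)$: there is a $*$-isomorphism $A\to C(\mathbb Z_n)$ mapping $u_{ij}$ to the function $k\mapsto\delta_{i,k+j}$, i.e. to the $(i,j)$ coordinate function of the group $\mathbb Z_n$ acting on itself by translations. (2) For a tensor product $h=h'\otimes h''$ of complex Hadamard matrices we have $A=A'\otimes A''$: there is a $*$-isomorphism from $A=A(h)$ onto the maximal $C^*$-tensor product of $A'=A(h')$ and $A''=A(h'')$ mapping $u_{ia,jb}$ to $u'_{ij}\otimes u''_{ab}$. (3) $A$ is commutative if and only if $h$ is equivalent to a tensor product of Fourier matrices $F_{d_1}\otimes\cdots\otimes F_{d_k}$. -/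

import Mathlib

open scoped TensorProduct Kronecker

noncomputable section

/-! ## Enveloping C*-algebras and the maximal tensor product -/

section Envelope

variable (𝒜 : Type*) [Ring 𝒜] [StarRing 𝒜] [Algebra ℂ 𝒜]

/-- A C*-seminorm on a complex unital *-algebra. -/
structure IsCStarSeminorm {𝒜 : Type*} [Ring 𝒜] [StarRing 𝒜] [Algebra ℂ 𝒜]
    (p : Seminorm ℂ 𝒜) : Prop where
  mul_le : ∀ a b, p (a * b) ≤ p a * p b
  star_mul_self : ∀ a, p (star a * a) = p a * p a

/-- The largest C*-seminorm of a *-algebra, i.e. the pointwise supremum of all of them. (`sSup` is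
this supremum whenever it is finite, as is the case for a *-algebra generated by
projections and for the algebraic tensor product of two C*-algebras.) -/
def maxCStarSeminorm : Seminorm ℂ 𝒜 := sSup {p | IsCStarSeminorm p}

theorem isCStarSeminorm_max : IsCStarSeminorm (maxCStarSeminorm 𝒜) := by
  have h0 : IsCStarSeminorm (⊥ : Seminorm ℂ 𝒜) := ⟨by simp, by simp⟩
  by_cases hb : BddAbove {p : Seminorm ℂ 𝒜 | IsCStarSeminorm p}
  · have hle : ∀ (p : Seminorm ℂ 𝒜), IsCStarSeminorm p → ∀ a, p a ≤ maxCStarSeminorm 𝒜 a :=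
      fun p hp a => le_csSup hb hp a
    have hne : Nonempty {p : Seminorm ℂ 𝒜 | IsCStarSeminorm p} := ⟨⟨⊥, h0⟩⟩
    have hsup : ∀ (a : 𝒜) (c : ℝ), (∀ (p : Seminorm ℂ 𝒜), IsCStarSeminorm p → p a ≤ c) →
        maxCStarSeminorm 𝒜 a ≤ c := by
      intro a c h
      rw [maxCStarSeminorm, Seminorm.sSup_apply hb]
      exact ciSup_le fun p => h p.1 p.2
    refine ⟨fun a b => hsup _ _ fun p hp => (hp.mul_le a b).trans
      (mul_le_mul (hle p hp a) (hle p hp b) (apply_nonneg p b) (apply_nonneg _ a)), fun a =>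
      le_antisymm (hsup _ _ fun p hp => ?_) ?_⟩
    · rw [hp.star_mul_self]
      exact mul_le_mul (hle p hp a) (hle p hp a) (apply_nonneg p a) (apply_nonneg _ a)
    · refine (mul_self_le_mul_self (apply_nonneg _ a) (hsup a (√(maxCStarSeminorm 𝒜 (star a * a)))
        fun p hp => Real.le_sqrt_of_sq_le ?_)).trans_eq (Real.mul_self_sqrt (apply_nonneg _ _))
      rw [sq, ← hp.star_mul_self]
      exact hle p hp _
  · have : maxCStarSeminorm 𝒜 = ⊥ := by
      rw [maxCStarSeminorm, sSup]
      exact dif_neg fun h => hb (Seminorm.bddAbove_iff.mpr h)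
    rw [this]
    exact h0

/-- The *-algebra `𝒜`, seminormed by its largest C*-seminorm. -/
def MaxSeminormed : Type _ := 𝒜

instance : Ring (MaxSeminormed 𝒜) := inferInstanceAs (Ring 𝒜)
instance : StarRing (MaxSeminormed 𝒜) := inferInstanceAs (StarRing 𝒜)
instance : Algebra ℂ (MaxSeminormed 𝒜) := inferInstanceAs (Algebra ℂ 𝒜)
instance [StarModule ℂ 𝒜] : StarModule ℂ (MaxSeminormed 𝒜) := inferInstanceAs (StarModule ℂ 𝒜)

instance : SeminormedRing (MaxSeminormed 𝒜) :=
  RingSeminorm.toSeminormedRing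
    { toFun := maxCStarSeminorm 𝒜
      map_zero' := map_zero _
      add_le' := map_add_le_add _
      neg' := map_neg_eq_map _
      mul_le' := (isCStarSeminorm_max 𝒜).mul_le }

theorem MaxSeminormed.norm_def (a : MaxSeminormed 𝒜) : ‖a‖ = maxCStarSeminorm 𝒜 a := rfl

instance : NormedAlgebra ℂ (MaxSeminormed 𝒜) where
  norm_smul_le c a := (map_smul_eq_mul (maxCStarSeminorm 𝒜) c a).le

theorem MaxSeminormed.norm_star_mul_self (a : MaxSeminormed 𝒜) : ‖star a * a‖ = ‖a‖ * ‖a‖ :=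
  (isCStarSeminorm_max 𝒜).star_mul_self a

instance : NormedStarGroup (MaxSeminormed 𝒜) where
  norm_star_le x := by
    rcases (norm_nonneg (star x)).eq_or_lt with hx | hx
    · rw [← hx]
      exact norm_nonneg x
    · refine le_of_mul_le_mul_right ?_ hx
      rw [← MaxSeminormed.norm_star_mul_self, star_star]
      exact norm_mul_le _ _

/-- The enveloping C*-algebra of `𝒜`: the Hausdorff completion of `𝒜` for its largest
C*-seminorm. -/
def CStarEnvelope : Type _ := UniformSpace.Completion (MaxSeminormed 𝒜)

namespace CStarEnvelope

open UniformSpace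

instance : NormedRing (CStarEnvelope 𝒜) :=
  inferInstanceAs (NormedRing (Completion (MaxSeminormed 𝒜)))

instance : CompleteSpace (CStarEnvelope 𝒜) :=
  inferInstanceAs (CompleteSpace (Completion (MaxSeminormed 𝒜)))

instance : Algebra ℂ (CStarEnvelope 𝒜) :=
  inferInstanceAs (Algebra ℂ (Completion (MaxSeminormed 𝒜)))

instance : NormedAlgebra ℂ (CStarEnvelope 𝒜) where
  norm_smul_le c x :=
    norm_smul_le c (show Completion (MaxSeminormed 𝒜) from x)

variable {𝒜} in
/-- The canonical map, on underlying sets. -/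
def mk (a : 𝒜) : CStarEnvelope 𝒜 := Completion.coe' (α := MaxSeminormed 𝒜) a

theorem mk_add (a b : 𝒜) : mk (a + b) = mk a + mk b :=
  Completion.coe_add (α := MaxSeminormed 𝒜) a b

theorem mk_mul (a b : 𝒜) : mk (a * b) = mk a * mk b :=
  Completion.coe_mul (α := MaxSeminormed 𝒜) a b

theorem mk_smul (c : ℂ) (a : 𝒜) : mk (c • a) = c • mk a :=
  Completion.coe_smul (X := MaxSeminormed 𝒜) c a

theorem norm_mk (a : 𝒜) : ‖mk a‖ = maxCStarSeminorm 𝒜 a :=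
  Completion.norm_coe (E := MaxSeminormed 𝒜) a

theorem denseRange_mk : DenseRange (mk : 𝒜 → CStarEnvelope 𝒜) :=
  Completion.denseRange_coe (α := MaxSeminormed 𝒜)

instance : Star (CStarEnvelope 𝒜) where
  star := Completion.map (star : MaxSeminormed 𝒜 → MaxSeminormed 𝒜)

theorem continuous_star : Continuous (star : CStarEnvelope 𝒜 → CStarEnvelope 𝒜) :=
  Completion.continuous_map

theorem mk_star (a : 𝒜) : mk (star a) = star (mk a) :=
  (Completion.map_coe (star_isometry (E := MaxSeminormed 𝒜)).uniformContinuous a).symm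

instance : StarRing (CStarEnvelope 𝒜) where
  star_involutive := by
    have hc := continuous_star 𝒜
    refine fun x => (denseRange_mk 𝒜).induction_on x
      (isClosed_eq (hc.comp hc) continuous_id) fun a => ?_
    rw [← mk_star, ← mk_star, star_star]
  star_mul := by
    have hc := continuous_star 𝒜
    refine fun x y => (denseRange_mk 𝒜).induction_on₂ (isClosed_eq
      (hc.comp (continuous_fst.mul continuous_snd))
      ((hc.comp continuous_snd).mul (hc.comp continuous_fst))) (fun a b => ?_) x y
    rw [← mk_mul, ← mk_star, ← mk_star, ← mk_star, ← mk_mul, star_mul]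
  star_add := by
    have hc := continuous_star 𝒜
    refine fun x y => (denseRange_mk 𝒜).induction_on₂ (isClosed_eq
      (hc.comp (continuous_fst.add continuous_snd))
      ((hc.comp continuous_fst).add (hc.comp continuous_snd))) (fun a b => ?_) x y
    rw [← mk_add, ← mk_star, ← mk_star, ← mk_star, ← mk_add, star_add]

instance : CStarRing (CStarEnvelope 𝒜) where
  norm_mul_self_le := by
    have hc := continuous_star 𝒜
    refine fun x => (denseRange_mk 𝒜).induction_on x
      (isClosed_le (continuous_norm.mul continuous_norm)
        (continuous_norm.comp (hc.mul continuous_id))) fun a => ?_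
    rw [← mk_star, ← mk_mul, norm_mk, norm_mk, (isCStarSeminorm_max 𝒜).star_mul_self]

variable [StarModule ℂ 𝒜]

instance : StarModule ℂ (CStarEnvelope 𝒜) where
  star_smul := by
    have hc := continuous_star 𝒜
    refine fun c x => (denseRange_mk 𝒜).induction_on x
      (isClosed_eq (hc.comp (continuous_const_smul c))
        ((continuous_const_smul (star c)).comp hc)) fun a => ?_
    rw [← mk_smul, ← mk_star, ← mk_star, ← mk_smul, star_smul]

instance : CStarAlgebra (CStarEnvelope 𝒜) where

/-- The canonical *-homomorphism of a *-algebra into its enveloping C*-algebra. -/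
def of : 𝒜 →⋆ₐ[ℂ] CStarEnvelope 𝒜 where
  toFun := mk
  map_one' := Completion.coe_one (MaxSeminormed 𝒜)
  map_mul' := mk_mul 𝒜
  map_zero' := Completion.coe_zero (α := MaxSeminormed 𝒜)
  map_add' := mk_add 𝒜
  commutes' _ := rfl
  map_star' := mk_star 𝒜

end CStarEnvelope

end Envelope

section MaxTensor

variable (A B : Type*) [CStarAlgebra A] [CStarAlgebra B]

/-- The (maximal) tensor product of two C*-algebras: the completion of the algebraic tensor
product for its largest C*-seminorm. -/
abbrev MaxTensor : Type _ := CStarEnvelope (A ⊗[ℂ] B)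

variable {A B} in
/-- The elementary tensor `a ⊗ b` in the tensor product of two C*-algebras. -/
def MaxTensor.tmul (a : A) (b : B) : MaxTensor A B := CStarEnvelope.of (A ⊗[ℂ] B) (a ⊗ₜ[ℂ] b)

end MaxTensor

/-! ## The *-algebra of quantum permutations -/

section QuantumPermutations

/-- The entries of `u` are idempotents which are pairwise orthogonal and sum up to `1` on each row
and on each column. (A magic unitary is such a matrix with self-adjoint entries.) -/
structure IsMagic {ι B : Type*} [Fintype ι] [Ring B] (u : ι → ι → B) : Prop where
  idem : ∀ i j, u i j * u i j = u i j
  row_orth : ∀ i j k, j ≠ k → u i j * u i k = 0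
  col_orth : ∀ i j k, i ≠ k → u i j * u k j = 0
  row_sum : ∀ i, ∑ j, u i j = 1
  col_sum : ∀ j, ∑ i, u i j = 1

variable (ι : Type*) [Fintype ι]

/-- The magic relations between the free variables `x i j`. -/
inductive MagicRel : FreeAlgebra ℂ (ι × ι) → FreeAlgebra ℂ (ι × ι) → Prop
  | idem (i j : ι) :
      MagicRel (FreeAlgebra.ι ℂ (i, j) * FreeAlgebra.ι ℂ (i, j)) (FreeAlgebra.ι ℂ (i, j))
  | row_orth (i j k : ι) (h : j ≠ k) :
      MagicRel (FreeAlgebra.ι ℂ (i, j) * FreeAlgebra.ι ℂ (i, k)) 0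
  | col_orth (i j k : ι) (h : i ≠ k) :
      MagicRel (FreeAlgebra.ι ℂ (i, j) * FreeAlgebra.ι ℂ (k, j)) 0
  | row_sum (i : ι) : MagicRel (∑ j, FreeAlgebra.ι ℂ (i, j)) 1
  | col_sum (j : ι) : MagicRel (∑ i, FreeAlgebra.ι ℂ (i, j)) 1

/-- The universal complex algebra generated by the entries of a magic matrix indexed by `ι`. With
the involution and the maps `comul`, `counit`, `antipode` below, this is the dense Hopf *-algebra
of the universal C*-algebra `A_s(n)`, `n = |ι|`, of the quantum permutation group. -/
def QPerm : Type _ := RingQuot (MagicRel ι)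

namespace QPerm

instance : Ring (QPerm ι) := inferInstanceAs (Ring (RingQuot (MagicRel ι)))
instance : Algebra ℂ (QPerm ι) := inferInstanceAs (Algebra ℂ (RingQuot (MagicRel ι)))

variable {ι}

/-- The standard generators `u i j` (the fundamental magic unitary). -/
def u (i j : ι) : QPerm ι := RingQuot.mkAlgHom ℂ (MagicRel ι) (FreeAlgebra.ι ℂ (i, j))

theorem isMagic_u : IsMagic (u : ι → ι → QPerm ι) where
  idem i j := by
    have := RingQuot.mkAlgHom_rel ℂ (MagicRel.idem i j)
    rwa [map_mul] at this
  row_orth i j k h := by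
    have := RingQuot.mkAlgHom_rel ℂ (MagicRel.row_orth i j k h)
    rwa [map_mul, map_zero] at this
  col_orth i j k h := by
    have := RingQuot.mkAlgHom_rel ℂ (MagicRel.col_orth i j k h)
    rwa [map_mul, map_zero] at this
  row_sum i := by
    have := RingQuot.mkAlgHom_rel ℂ (MagicRel.row_sum i)
    rwa [map_sum, map_one] at this
  col_sum j := by
    have := RingQuot.mkAlgHom_rel ℂ (MagicRel.col_sum j)
    rwa [map_sum, map_one] at this

variable {B : Type*} [Ring B] [Algebra ℂ B]

/-- The universal property: a magic matrix `v` over an algebra `B` yields an algebra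
homomorphism with `u i j ↦ v i j`. -/
def lift (v : ι → ι → B) (hv : IsMagic v) : QPerm ι →ₐ[ℂ] B :=
  RingQuot.liftAlgHom ℂ ⟨FreeAlgebra.lift ℂ fun x => v x.1 x.2, by
    intro x y h
    induction h with
    | idem i j => simpa using hv.idem i j
    | row_orth i j k h => simpa using hv.row_orth i j k h
    | col_orth i j k h => simpa using hv.col_orth i j k h
    | row_sum i => simpa using hv.row_sum i
    | col_sum j => simpa using hv.col_sum j⟩

theorem lift_u (v : ι → ι → B) (hv : IsMagic v) (i j : ι) : lift v hv (u i j) = v i j := by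
  have := RingQuot.liftAlgHom_mkAlgHom_apply ℂ (FreeAlgebra.lift ℂ fun x : ι × ι => v x.1 x.2)
    (s := MagicRel ι) (by
      intro x y h
      induction h with
      | idem i j => simpa using hv.idem i j
      | row_orth i j k h => simpa using hv.row_orth i j k h
      | col_orth i j k h => simpa using hv.col_orth i j k h
      | row_sum i => simpa using hv.row_sum i
      | col_sum j => simpa using hv.col_sum j) (FreeAlgebra.ι ℂ (i, j))
  rw [FreeAlgebra.lift_ι_apply] at this
  exact this

theorem algHom_ext {f g : QPerm ι →ₐ[ℂ] B} (h : ∀ i j, f (u i j) = g (u i j)) : f = g := by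
  refine RingQuot.ringQuot_ext' ℂ f g (FreeAlgebra.hom_ext ?_)
  ext ⟨i, j⟩
  exact h i j

/-- Comultiplication, `Δ(u i j) = ∑ k, u i k ⊗ u k j`. -/
def comul : QPerm ι →ₐ[ℂ] QPerm ι ⊗[ℂ] QPerm ι :=
  lift (fun i j => ∑ k, u i k ⊗ₜ[ℂ] u k j) (by
    classical
    have hu := isMagic_u (ι := ι)
    have hrow : ∀ i j k, u i j * u i k = if j = k then (u i j : QPerm ι) else 0 := by
      intro i j k
      split_ifs with h
      · rw [← h, hu.idem]
      · exact hu.row_orth i j k h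
    have hcol : ∀ i j k, u i j * u k j = if i = k then (u i j : QPerm ι) else 0 := by
      intro i j k
      split_ifs with h
      · rw [← h, hu.idem]
      · exact hu.col_orth i j k h
    refine ⟨fun i j => ?_, fun i j k h => ?_, fun i j k h => ?_, fun i => ?_, fun j => ?_⟩
    · simp [Finset.sum_mul, Finset.mul_sum, hrow, TensorProduct.ite_tmul]
    · simp [Finset.sum_mul, Finset.mul_sum, hrow, TensorProduct.ite_tmul, h]
    · simp [Finset.sum_mul, Finset.mul_sum, hcol, TensorProduct.tmul_ite, h]
    · rw [Finset.sum_comm]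
      simp [← TensorProduct.tmul_sum, ← TensorProduct.sum_tmul, hu.row_sum,
        Algebra.TensorProduct.one_def]
    · rw [Finset.sum_comm]
      simp [← TensorProduct.tmul_sum, ← TensorProduct.sum_tmul, hu.col_sum,
        Algebra.TensorProduct.one_def])

/-- Counit, `ε(u i j) = δ i j`. -/
def counit [DecidableEq ι] : QPerm ι →ₐ[ℂ] ℂ :=
  lift (fun i j => if i = j then 1 else 0) (by
    refine ⟨fun i j => ?_, fun i j k h => ?_, fun i j k h => ?_, fun i => ?_, fun j => ?_⟩
    · simp
    · simpa using fun h' h'' => h (h''.symm.trans h')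
    · simpa using fun h' h'' => h (h''.trans h'.symm)
    · simp
    · simp)

/-- Antipode, `S(u i j) = u j i` (which is `(u j i)*`), a homomorphism to the opposite algebra. -/
def antipode : QPerm ι →ₐ[ℂ] (QPerm ι)ᵐᵒᵖ :=
  lift (fun i j => MulOpposite.op (u j i)) (by
    have hu := isMagic_u (ι := ι)
    refine ⟨fun i j => ?_, fun i j k h => ?_, fun i j k h => ?_, fun i => ?_, fun j => ?_⟩
    · rw [← MulOpposite.op_mul, hu.idem]
    · rw [← MulOpposite.op_mul, hu.col_orth _ _ _ h.symm, MulOpposite.op_zero]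
    · rw [← MulOpposite.op_mul, hu.row_orth _ _ _ h.symm, MulOpposite.op_zero]
    · rw [← Finset.op_sum, hu.col_sum, MulOpposite.op_one]
    · rw [← Finset.op_sum, hu.row_sum, MulOpposite.op_one])

end QPerm

/-- The opposite ring of a complex algebra, with scalars acting through complex conjugation. -/
def ConjOp (B : Type*) : Type _ := Bᵐᵒᵖ

namespace ConjOp

variable (B : Type*) [Ring B] [Algebra ℂ B]

instance : Ring (ConjOp B) := inferInstanceAs (Ring Bᵐᵒᵖ)

instance : Algebra ℂ (ConjOp B) :=
  RingHom.toAlgebra' ((algebraMap ℂ Bᵐᵒᵖ).comp (starRingEnd ℂ)) fun c x =>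
    Algebra.commutes (A := Bᵐᵒᵖ) (starRingEnd ℂ c) x

end ConjOp

namespace QPerm

/-- The involution as an algebra homomorphism to the conjugate opposite algebra,
fixing the generators. -/
def starHom : QPerm ι →ₐ[ℂ] ConjOp (QPerm ι) :=
  lift (B := ConjOp (QPerm ι)) (fun i j => MulOpposite.op (u i j)) (by
    have hu := isMagic_u (ι := ι)
    refine ⟨fun i j => ?_, fun i j k h => ?_, fun i j k h => ?_, fun i => ?_, fun j => ?_⟩
    · exact congrArg MulOpposite.op (hu.idem i j)
    · exact congrArg MulOpposite.op (hu.row_orth _ _ _ h.symm)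
    · exact congrArg MulOpposite.op (hu.col_orth _ _ _ h.symm)
    · exact (Finset.op_sum _ _).symm.trans (congrArg MulOpposite.op (hu.row_sum i))
    · exact (Finset.op_sum _ _).symm.trans (congrArg MulOpposite.op (hu.col_sum j)))

instance : Star (QPerm ι) := ⟨fun x => MulOpposite.unop (starHom ι x)⟩

variable {ι}

theorem star_u (i j : ι) : star (u i j) = u i j :=
  congrArg MulOpposite.unop (lift_u (B := ConjOp (QPerm ι)) _ _ i j)

theorem star_mul' (x y : QPerm ι) : star (x * y) = star y * star x :=
  congrArg MulOpposite.unop (map_mul (starHom ι) x y)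

theorem star_add' (x y : QPerm ι) : star (x + y) = star x + star y :=
  congrArg MulOpposite.unop (map_add (starHom ι) x y)

theorem star_algebraMap' (c : ℂ) :
    star (algebraMap ℂ (QPerm ι) c) = algebraMap ℂ (QPerm ι) (star c) :=
  congrArg MulOpposite.unop ((starHom ι).commutes c)

/-- Applying the involution twice is an algebra endomorphism. -/
def starStar : QPerm ι →ₐ[ℂ] QPerm ι where
  toFun x := star (star x)
  map_one' := by
    have h := star_algebraMap' (ι := ι) 1
    rw [map_one, star_one, map_one] at h
    rw [h, h]
  map_mul' x y := by rw [star_mul', star_mul']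
  map_zero' := by
    have h := star_algebraMap' (ι := ι) 0
    rw [map_zero, star_zero, map_zero] at h
    rw [h, h]
  map_add' x y := by rw [star_add', star_add']
  commutes' c := by rw [star_algebraMap', star_algebraMap', star_star]

instance : StarRing (QPerm ι) where
  star_involutive x := by
    have h : (starStar : QPerm ι →ₐ[ℂ] QPerm ι) = AlgHom.id ℂ _ := algHom_ext fun i j =>
      show star (star (u i j)) = u i j by rw [star_u, star_u]
    exact congrArg (fun f : QPerm ι →ₐ[ℂ] QPerm ι => f x) h
  star_mul := star_mul'
  star_add := star_add'

instance : StarModule ℂ (QPerm ι) where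
  star_smul c x := by
    rw [Algebra.smul_def, Algebra.smul_def, star_mul', star_algebraMap', Algebra.commutes]

end QPerm

end QuantumPermutations

/-! ## Hopf images -/

section HopfImage

variable {ι : Type*} [Fintype ι] [DecidableEq ι]

/-- Hopf *-ideals of the Hopf *-algebra of quantum permutations: two-sided ideals `J` with
`Δ(J) ⊆ J ⊗ 𝒜 + 𝒜 ⊗ J`, `ε(J) = 0`, `S(J) ⊆ J` and `J* ⊆ J`. -/
structure IsHopfStarIdeal (J : TwoSidedIdeal (QPerm ι)) : Prop where
  comul_mem : ∀ x ∈ J, QPerm.comul x ∈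
    Submodule.span ℂ {t : QPerm ι ⊗[ℂ] QPerm ι | ∃ a b, (a ∈ J ∨ b ∈ J) ∧ t = a ⊗ₜ[ℂ] b}
  counit_eq_zero : ∀ x ∈ J, QPerm.counit x = 0
  antipode_mem : ∀ x ∈ J, (QPerm.antipode x).unop ∈ J
  star_mem : ∀ x ∈ J, star x ∈ J

variable {B : Type*} [Ring B] [Algebra ℂ B] (π : QPerm ι →ₐ[ℂ] B)

/-- The largest Hopf *-ideal contained in the kernel of `π` (the sum of all of these). -/
def hopfKernel : TwoSidedIdeal (QPerm ι) :=
  sSup {J | IsHopfStarIdeal J ∧ ∀ x ∈ J, π x = 0}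

theorem star_mem_hopfKernel {x : QPerm ι} (hx : x ∈ hopfKernel π) : star x ∈ hopfKernel π := by
  let K : TwoSidedIdeal (QPerm ι) := TwoSidedIdeal.mk' {x | star x ∈ hopfKernel π}
    (by simp)
    (fun {x y} hx hy => by simpa using (hopfKernel π).add_mem hx hy)
    (fun {x} hx => by simpa using (hopfKernel π).neg_mem hx)
    (fun {x y} hy => by simpa using (hopfKernel π).mul_mem_right _ _ hy)
    (fun {x y} hx => by simpa using (hopfKernel π).mul_mem_left _ _ hx)
  have hK : hopfKernel π ≤ K := sSup_le fun J hJ x hx => by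
    have h : J ≤ hopfKernel π := le_sSup hJ
    have h' : star x ∈ hopfKernel π := h (hJ.1.star_mem x hx)
    simpa [K] using h'
  simpa [K] using hK hx

/-- The Hopf image of `π`: the quotient of the Hopf *-algebra of quantum permutations by the largest
Hopf *-ideal contained in the kernel of `π`. It is the smallest Hopf *-algebra quotient through
which `π` factors. -/
def HopfImage : Type _ := (hopfKernel π).ringCon.Quotient

namespace HopfImage

instance : Ring (HopfImage π) := inferInstanceAs (Ring (hopfKernel π).ringCon.Quotient)
instance : Algebra ℂ (HopfImage π) := inferInstanceAs (Algebra ℂ (hopfKernel π).ringCon.Quotient)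

/-- The quotient map. -/
def mk : QPerm ι →ₐ[ℂ] HopfImage π where
  __ := (hopfKernel π).ringCon.mk'
  commutes' _ := rfl

theorem mk_surjective : Function.Surjective (mk π) := (hopfKernel π).ringCon.mk'_surjective

instance : Star (HopfImage π) where
  star := Quotient.map' star fun x y h => by
    have h' := ((hopfKernel π).rel_iff x y).mp h
    refine ((hopfKernel π).rel_iff (star x) (star y)).mpr ?_
    rw [← star_sub]
    exact star_mem_hopfKernel π h'

theorem mk_star (x : QPerm ι) : mk π (star x) = star (mk π x) := rfl

instance : StarRing (HopfImage π) where
  star_involutive x := by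
    obtain ⟨x, rfl⟩ := mk_surjective π x
    rw [← mk_star, ← mk_star, star_star]
  star_mul x y := by
    obtain ⟨x, rfl⟩ := mk_surjective π x
    obtain ⟨y, rfl⟩ := mk_surjective π y
    rw [← map_mul, ← mk_star, ← mk_star, ← mk_star, star_mul, map_mul]
  star_add x y := by
    obtain ⟨x, rfl⟩ := mk_surjective π x
    obtain ⟨y, rfl⟩ := mk_surjective π y
    rw [← map_add, ← mk_star, ← mk_star, ← mk_star, star_add, map_add]

instance : StarModule ℂ (HopfImage π) where
  star_smul c x := by
    obtain ⟨x, rfl⟩ := mk_surjective π x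
    rw [← map_smul, ← mk_star, ← mk_star, star_smul, map_smul]

end HopfImage

end HopfImage

/-! ## The quantum permutation algebra of a complex Hadamard matrix -/

section Hadamard

variable {ι : Type*} [Fintype ι]

/-- The orthogonal projection of `ℂ^ι` onto the line spanned by the vector `ξ`. -/
def lineProjection (ξ : ι → ℂ) : Matrix ι ι ℂ :=
  (star ξ ⬝ᵥ ξ)⁻¹ • Matrix.vecMulVec ξ (star ξ)

/-- The magic basis `ξ i j = h_j / h_i`, where `h_i` are the rows of `h`. -/
def magicBasis (h : Matrix ι ι ℂ) (i j : ι) : ι → ℂ := h j / h i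

variable [DecidableEq ι] {h : Matrix ι ι ℂ}

theorem isMagic_lineProjection (hh : h.IsHadamard) :
    IsMagic fun i j => lineProjection (magicBasis h i j) := by
  have hu : ∀ i k, h i k * star (h i k) = 1 := fun i k => (Unitary.mem_iff.mp (hh.apply_mem i k)).2
  have hu' : ∀ i k, star (h i k) * h i k = 1 := fun i k => (Unitary.mem_iff.mp (hh.apply_mem i k)).1
  have hinv : ∀ i k, (h i k)⁻¹ = star (h i k) := fun i k =>
    inv_eq_of_mul_eq_one_right (hu i k)
  have hξ : ∀ i j k, magicBasis h i j k = h j k * star (h i k) := fun i j k => by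
    rw [magicBasis, Pi.div_apply, div_eq_mul_inv, hinv]
  have hrow : ∀ i j, ∑ k, h i k * star (h j k) = if i = j then (Fintype.card ι : ℂ) else 0 := by
    intro i j
    have := congrFun (congrFun hh.mul_conjTranspose i) j
    simpa [Matrix.mul_apply, Matrix.one_apply] using this
  have hcol : ∀ k l, ∑ i, h i k * star (h i l) = if k = l then (Fintype.card ι : ℂ) else 0 := by
    intro k l
    have := congrFun (congrFun hh.conjTranspose_mul l) k
    simp only [Matrix.mul_apply, Matrix.conjTranspose_apply, Matrix.smul_apply, Matrix.one_apply,
      smul_eq_mul, mul_ite, mul_one, mul_zero] at this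
    simp only [mul_comm (h _ k), this, eq_comm]
  have hdot : ∀ i j i' j', star (magicBasis h i j) ⬝ᵥ magicBasis h i' j' =
      ∑ k, (h i k * star (h i' k)) * (h j' k * star (h j k)) := by
    intro i j i' j'
    refine Finset.sum_congr rfl fun k _ => ?_
    rw [Pi.star_apply, hξ, hξ, star_mul, star_star]
    ring
  have hdr : ∀ i j j', star (magicBasis h i j) ⬝ᵥ magicBasis h i j' =
      if j' = j then (Fintype.card ι : ℂ) else 0 := fun i j j' => by
    rw [hdot]
    simp only [hu, one_mul, hrow]
  have hdc : ∀ i i' j, star (magicBasis h i j) ⬝ᵥ magicBasis h i' j =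
      if i = i' then (Fintype.card ι : ℂ) else 0 := fun i i' j => by
    rw [hdot]
    simp only [hu, mul_one, hrow]
  have hcard : ∀ _ : ι, (Fintype.card ι : ℂ) ≠ 0 := fun i => by
    have : Nonempty ι := ⟨i⟩
    exact Nat.cast_ne_zero.mpr Fintype.card_ne_zero
  have hP : ∀ i j, lineProjection (magicBasis h i j) = (Fintype.card ι : ℂ)⁻¹ •
      Matrix.vecMulVec (magicBasis h i j) (star (magicBasis h i j)) := fun i j => by
    rw [lineProjection, hdr, if_pos rfl]
  have hmul : ∀ i j i' j', lineProjection (magicBasis h i j) *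
      lineProjection (magicBasis h i' j') = ((Fintype.card ι : ℂ)⁻¹ * (Fintype.card ι : ℂ)⁻¹ *
        (star (magicBasis h i j) ⬝ᵥ magicBasis h i' j')) •
      Matrix.vecMulVec (magicBasis h i j) (star (magicBasis h i' j')) := by
    intro i j i' j'
    rw [hP, hP, smul_mul_smul_comm, Matrix.vecMulVec_mul_vecMulVec]
    simp [Matrix.vecMulVec_smul, smul_smul]
  refine ⟨fun i j => ?_, fun i j k hjk => ?_, fun i j k hik => ?_, fun i => ?_, fun j => ?_⟩
  · rw [hmul, hdr, if_pos rfl, inv_mul_cancel_right₀ (hcard i), ← hP]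
  · simp only [hmul, hdr, if_neg (Ne.symm hjk), mul_zero, zero_smul]
  · simp only [hmul, hdc, if_neg hik, mul_zero, zero_smul]
  · ext k l
    have : ∀ j, h j k * star (h i k) * (star (h j l) * h i l) =
        (star (h i k) * h i l) * (h j k * star (h j l)) := fun j => by ring
    simp only [hP, Matrix.sum_apply, Matrix.smul_apply, Matrix.vecMulVec_apply, Pi.star_apply, hξ,
      star_mul, star_star, smul_eq_mul, Matrix.one_apply, ← Finset.mul_sum]
    simp only [mul_comm (h i l), this, ← Finset.mul_sum, hcol]
    split_ifs with hkl
    · rw [hkl, hu', one_mul, inv_mul_cancel₀ (hcard i)]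
    · simp
  · ext k l
    have : ∀ i, h j k * star (h i k) * (h i l * star (h j l)) =
        (h j k * star (h j l)) * (h i l * star (h i k)) := fun i => by ring
    simp only [hP, Matrix.sum_apply, Matrix.smul_apply, Matrix.vecMulVec_apply, Pi.star_apply, hξ,
      star_mul, star_star, smul_eq_mul, Matrix.one_apply, ← Finset.mul_sum]
    simp only [this, ← Finset.mul_sum, hcol, eq_comm (a := l)]
    split_ifs with h1
    · rw [← h1, hu, one_mul, inv_mul_cancel₀ (hcard j)]
    · simp

/-- The representation of the algebra of quantum permutations on `ℂ^ι` associated with `h`,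
`u i j ↦ P (h_j / h_i)`. -/
def hadamardRep (hh : h.IsHadamard) : QPerm ι →ₐ[ℂ] Matrix ι ι ℂ :=
  QPerm.lift (fun i j => lineProjection (magicBasis h i j)) (isMagic_lineProjection hh)

/-- The quantum permutation algebra `A` of a complex Hadamard matrix: the full C*-algebra of the
Hopf image of the associated representation. -/
abbrev HadamardAlgebra (hh : h.IsHadamard) : Type _ := CStarEnvelope (HopfImage (hadamardRep hh))

/-- The fundamental magic unitary of the quantum permutation algebra of `h`. -/
def HadamardAlgebra.u (hh : h.IsHadamard) (i j : ι) : HadamardAlgebra hh :=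
  CStarEnvelope.of _ (HopfImage.mk (hadamardRep hh) (QPerm.u i j))

end Hadamard

/-! ## Fourier matrices -/

section Fourier

/-- The Fourier matrix `w ^ (i j)`, `w = exp (2 π i / n)`, indexed by `ℤ/n`. -/
def fourierMatrix (n : ℕ) : Matrix (ZMod n) (ZMod n) ℂ :=
  fun i j => Complex.exp (2 * Real.pi * Complex.I / n) ^ (i.val * j.val)

theorem fourierMatrix_apply (n : ℕ) [NeZero n] (i j : ZMod n) :
    fourierMatrix n i j = ZMod.stdAddChar (i * j) := by
  have h : i * j = (((i.val * j.val : ℕ) : ℤ) : ZMod n) := by simp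
  rw [h, ZMod.stdAddChar_coe, fourierMatrix, ← Complex.exp_nat_mul]
  congr 1
  push_cast
  ring

theorem isHadamard_fourierMatrix (n : ℕ) [NeZero n] : (fourierMatrix n).IsHadamard := by
  have hs : ∀ x : ZMod n, star (ZMod.stdAddChar x : ℂ) = ZMod.stdAddChar (-x) := fun x => by
    rw [ZMod.stdAddChar_apply, ZMod.stdAddChar_apply, AddChar.map_neg_eq_inv, Circle.coe_inv_eq_conj]
    rfl
  have hsum : ∀ a : ZMod n, ∑ k : ZMod n, (ZMod.stdAddChar (k * a) : ℂ) =
      if a = 0 then (n : ℂ) else 0 := fun a => by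
    rw [AddChar.sum_mulShift a (ZMod.isPrimitive_stdAddChar n), ZMod.card]
    split_ifs <;> simp
  refine ⟨fun i j => ?_, ?_, ?_⟩
  · rw [fourierMatrix_apply, Unitary.mem_iff, hs, ← AddChar.map_add_eq_mul,
      ← AddChar.map_add_eq_mul]
    simp
  · ext i j
    have : ∀ k, i * k + -(j * k) = k * (i - j) := fun k => by ring
    simp only [Matrix.mul_apply, Matrix.conjTranspose_apply, fourierMatrix_apply, hs,
      ← AddChar.map_add_eq_mul, this, hsum, sub_eq_zero, Matrix.smul_apply, Matrix.one_apply,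
      ZMod.card, smul_eq_mul, mul_ite, mul_one, mul_zero]
  · ext i j
    have : ∀ k, -(k * i) + k * j = k * (j - i) := fun k => by ring
    simp only [Matrix.mul_apply, Matrix.conjTranspose_apply, fourierMatrix_apply, hs,
      ← AddChar.map_add_eq_mul, this, hsum, sub_eq_zero, Matrix.smul_apply, Matrix.one_apply,
      ZMod.card, smul_eq_mul, mul_ite, mul_one, mul_zero, eq_comm]

/-- The tensor product of the Fourier matrices of sizes `d 0, …, d (k - 1)`. -/
def fourierTensor {k : ℕ} (d : Fin k → ℕ+) :
    Matrix (∀ s, ZMod (d s)) (∀ s, ZMod (d s)) ℂ :=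
  fun x y => ∏ s, fourierMatrix (d s) (x s) (y s)

/-- Equivalence of Hadamard matrices: `h'` is obtained from `h` by permuting the rows and the
columns and by multiplying the rows and the columns by complex numbers of modulus one. -/
def HadamardEquivalent {ι κ : Type*} (h : Matrix ι ι ℂ) (h' : Matrix κ κ ℂ) : Prop :=
  ∃ (σ τ : ι ≃ κ) (a b : ι → Circle), ∀ i j, h i j = a i * b j * h' (σ i) (τ j)

/-- The coordinate functions `k ↦ δ (i = k + j)` of the group `ℤ/n`, acting on itself by
translations and thus viewed as a group of permutation matrices. -/
def cyclicMagic {n : ℕ} (i j : ZMod n) : C(ZMod n, ℂ) where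
  toFun k := if k + j = i then 1 else 0
  continuous_toFun := continuous_of_discreteTopology

end Fourier

end

open scoped TensorProduct Kronecker

noncomputable section

/-! ## C*-seminorms and the universal property of the enveloping C*-algebra -/

/-! Write `π` for the representation attached to `h` and `P i j` for its values on generators. To
identify the Hopf image of `π` with an explicit algebra, one exhibits a surjection `ψ` of `QPerm`
whose kernel is a Hopf *-ideal inside `ker π`; maximality gives `ker ψ ≤ hopfKernel π`, and the
reverse inclusion needs a separate argument. Passing to C*-envelopes is then formal, once the
largest C*-seminorm is known to be finite: generators are projections, and on a C*-algebra every
C*-seminorm is dominated by the norm.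

Fourier matrices: the vector at `(i, j)` is the character of `ℤ/n` with parameter `j - i`, so `π`
factors through `C(ℤ/n)`. The factor is injective, since the `P m 0` are nonzero and mutually
orthogonal. Hence `ker π` is itself a Hopf *-ideal (`hopfKernel_fourierMatrix`).

Tensor products: `P (i, a) (j, b)` is the Kronecker product of `P' i j` and `P'' a b`, so `π`
factors through the tensor product of the two Hopf images. For the reverse inclusion, restrict a
quantum permutation of `ι × κ` to either factor by applying the counit to the other one; these
restrictions, combined with the comultiplication, recover the map to the tensor product
(`tensorRep_eq_comul`). It remains that they respect Hopf kernels. This holds because `P'' a b`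
fixes the constant vector when `a = b` and kills it otherwise, so `ℂ^ι ⊗ 1` is invariant and carries
the representation of `h'` pulled back along the restriction. The conclusion is
`hopfKernel_kronecker`.

Commutativity: `A` is commutative iff the `P i j` commute. In one direction `π` extends to `A`; in
the other, the commutator ideal is a Hopf *-ideal, so it lies in the Hopf kernel. Commuting rank-one
projections are equal or orthogonal. As `∑ m, P o m = 1`, every quotient `h_j / h_i` is then
proportional to some `h_m / h_o`; after normalization the rows form a finite group of torus-valued
functions, the columns are its characters, and the classification of finite abelian groups yields a
tensor product of Fourier matrices. Conversely, for such a matrix the quotients of rows are again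
rows up to scalars, so the projections are equal or orthogonal. -/

theorem starAlgHom_continuous {A B : Type*} [CStarAlgebra A] [CStarAlgebra B]
    (f : A →⋆ₐ[ℂ] B) : Continuous f :=
  AddMonoidHomClass.continuous_of_bound f 1 fun x => by
    simpa using NonUnitalStarAlgHom.norm_apply_le f x

namespace IsCStarSeminorm

theorem comp {𝒜 ℬ : Type*} [Ring 𝒜] [StarRing 𝒜] [Algebra ℂ 𝒜] [Ring ℬ] [StarRing ℬ]
    [Algebra ℂ ℬ] {p : Seminorm ℂ ℬ} (hp : IsCStarSeminorm p) (f : 𝒜 →⋆ₐ[ℂ] ℬ) :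
    IsCStarSeminorm (p.comp f.toAlgHom.toLinearMap) where
  mul_le a b := by simpa using hp.mul_le (f a) (f b)
  star_mul_self a := by simpa [map_star] using hp.star_mul_self (f a)

theorem norm (B : Type*) [CStarAlgebra B] : IsCStarSeminorm (normSeminorm ℂ B) where
  mul_le a b := norm_mul_le a b
  star_mul_self a := CStarRing.norm_star_mul_self (x := a)

variable {𝒜 : Type*} [Ring 𝒜] [StarRing 𝒜] [Algebra ℂ 𝒜] {p : Seminorm ℂ 𝒜}

theorem le_one_of_star_mul_self_le (hp : IsCStarSeminorm p) {a : 𝒜} (ha : p (star a * a) ≤ 1) :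
    p a ≤ 1 := by
  rw [hp.star_mul_self] at ha
  nlinarith [apply_nonneg p a]

/-- The C*-identity reads `p a = p a ^ 2` on a projection. This bound, uniform in `p`, makes the
largest C*-seminorm of a Hopf image finite. -/
theorem le_one_of_isStarProjection (hp : IsCStarSeminorm p) {a : 𝒜} (ha : IsStarProjection a) :
    p a ≤ 1 := by
  have h := hp.star_mul_self a
  rw [ha.isSelfAdjoint.star_eq, ha.isIdempotentElem.eq] at h
  nlinarith [apply_nonneg p a]

theorem one_le (hp : IsCStarSeminorm p) : p 1 ≤ 1 :=
  hp.le_one_of_isStarProjection (.one 𝒜)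

theorem map_star_eq (hp : IsCStarSeminorm p) (a : 𝒜) : p (star a) = p a := by
  have key : ∀ b, p b ≤ p (star b) := fun b => by
    rcases (apply_nonneg p b).eq_or_lt with h | h
    · rw [← h]
      exact apply_nonneg p _
    · refine le_of_mul_le_mul_right ?_ h
      rw [← hp.star_mul_self]
      exact hp.mul_le _ _
  exact le_antisymm (by simpa using key (star a)) (key a)

/-- On a C*-algebra, every C*-seminorm is dominated by the norm. -/
theorem le_norm {A : Type*} [CStarAlgebra A] {p : Seminorm ℂ A} (hp : IsCStarSeminorm p) (a : A) :
    p a ≤ ‖a‖ := by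
  let : PartialOrder A := CStarAlgebra.spectralOrder A
  let : StarOrderedRing A := CStarAlgebra.spectralOrderedRing A
  -- A self-adjoint contraction is the real part of the unitary `b + i √(1 - b²)`, and `p` is at
  -- most `1` on unitaries.
  have hball : ∀ b : selfAdjoint A, ‖b‖ ≤ 1 → p (b : A) ≤ 1 := fun b hb => by
    set v := selfAdjoint.unitarySelfAddISMul b hb with hv
    have hv1 : p (v : A) ≤ 1 := hp.le_one_of_star_mul_self_le (by
      rw [Unitary.coe_star_mul_self]
      exact hp.one_le)
    have hb' : (b : A) = (2⁻¹ : ℂ) • ((v : A) + star (v : A)) := by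
      have := congrArg (fun x : selfAdjoint A => (x : A))
        (selfAdjoint.realPart_unitarySelfAddISMul b hb)
      rw [← this, realPart_apply_coe, ← hv]
      rw [← Complex.coe_smul]
      norm_num
    rw [hb', map_smul_eq_mul]
    have := map_add_le_add p (v : A) (star (v : A))
    rw [hp.map_star_eq] at this
    norm_num
    linarith
  have hsa : ∀ b : A, IsSelfAdjoint b → p b ≤ ‖b‖ := fun b hb => by
    rcases (norm_nonneg b).eq_or_lt with h | h
    · rw [norm_eq_zero.mp h.symm]
      simp
    · have hc : IsSelfAdjoint ((‖b‖⁻¹ : ℝ) • b) := (IsSelfAdjoint.all (‖b‖⁻¹ : ℝ)).smul hb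
      have h1 : ‖((‖b‖⁻¹ : ℝ) • b)‖ ≤ 1 := by
        rw [norm_smul, norm_inv, norm_norm, inv_mul_cancel₀ h.ne']
      have := hball ⟨_, hc⟩ h1
      simp only [← Complex.coe_smul, map_smul_eq_mul] at this
      rw [Complex.norm_real, norm_inv, norm_norm, inv_mul_le_iff₀ h, mul_one] at this
      exact this
  -- The C*-identity, valid for both `p` and the norm, reduces a general element to a self-adjoint
  -- one.
  have h := hsa (star a * a) (.star_mul_self a)
  rw [hp.star_mul_self, CStarRing.norm_star_mul_self] at h
  exact (mul_self_le_mul_self_iff (apply_nonneg p a) (norm_nonneg a)).mpr h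

/-- The C*-seminorms of a *-algebra are bounded as soon as they are so on each element. -/
theorem bddAbove_of_forall (h : ∀ a : 𝒜, ∃ C : ℝ, ∀ p : Seminorm ℂ 𝒜, IsCStarSeminorm p → p a ≤ C) :
    BddAbove {p : Seminorm ℂ 𝒜 | IsCStarSeminorm p} := by
  choose C hC using h
  rw [Seminorm.bddAbove_iff]
  refine ⟨C, ?_⟩
  rintro _ ⟨p, hp, rfl⟩
  exact fun a => hC a p hp

variable (𝒜) in
/-- The elements on which the C*-seminorms are uniformly bounded. -/
def boundedElements : Subalgebra ℂ 𝒜 where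
  carrier := {a | ∃ C : ℝ, ∀ p : Seminorm ℂ 𝒜, IsCStarSeminorm p → p a ≤ C}
  mul_mem' := by
    rintro a b ⟨C, hC⟩ ⟨D, hD⟩
    refine ⟨C * D, fun p hp => (hp.mul_le a b).trans ?_⟩
    exact mul_le_mul (hC p hp) (hD p hp) (apply_nonneg p b) ((apply_nonneg p a).trans (hC p hp))
  add_mem' := by
    rintro a b ⟨C, hC⟩ ⟨D, hD⟩
    exact ⟨C + D, fun p hp => (map_add_le_add p a b).trans (add_le_add (hC p hp) (hD p hp))⟩
  algebraMap_mem' c := ⟨‖c‖, fun p hp => by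
    rw [Algebra.algebraMap_eq_smul_one, map_smul_eq_mul]
    exact mul_le_of_le_one_right (norm_nonneg c) hp.one_le⟩

/-- A C*-seminorm restricts to C*-seminorms on `A ⊗ 1` and `1 ⊗ B`, where `le_norm` bounds it, so
its value at `a ⊗ b` is at most `‖a‖ * ‖b‖`. Without boundedness, `sSup` would be the zero seminorm.
-/
theorem bddAbove_tensorProduct (A B : Type*) [CStarAlgebra A] [CStarAlgebra B] :
    BddAbove {p : Seminorm ℂ (A ⊗[ℂ] B) | IsCStarSeminorm p} := by
  refine bddAbove_of_forall fun t => ?_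
  let l : A →⋆ₐ[ℂ] A ⊗[ℂ] B := { Algebra.TensorProduct.includeLeft with
    map_star' := fun a => by simp }
  let r : B →⋆ₐ[ℂ] A ⊗[ℂ] B := { Algebra.TensorProduct.includeRight with
    map_star' := fun a => by simp }
  change t ∈ boundedElements (A ⊗[ℂ] B)
  induction t using TensorProduct.induction_on with
  | zero => exact zero_mem _
  | add x y hx hy => exact add_mem hx hy
  | tmul a b =>
    have : a ⊗ₜ[ℂ] b = l a * r b := by
      change _ = a ⊗ₜ[ℂ] (1 : B) * (1 : A) ⊗ₜ[ℂ] b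
      simp
    rw [this]
    exact mul_mem ⟨‖a‖, fun p hp => (hp.comp l).le_norm a⟩
      ⟨‖b‖, fun p hp => (hp.comp r).le_norm b⟩

end IsCStarSeminorm

namespace CStarEnvelope

variable {𝒜 : Type*} [Ring 𝒜] [StarRing 𝒜] [Algebra ℂ 𝒜] {B : Type*} [CStarAlgebra B]

theorem denseRange_of : DenseRange (of 𝒜) := denseRange_mk 𝒜

/-- The underlying function of `CStarEnvelope.lift`. -/
def liftFun (f : 𝒜 →⋆ₐ[ℂ] B) : CStarEnvelope 𝒜 → B :=
  UniformSpace.Completion.extension (α := MaxSeminormed 𝒜) f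

theorem continuous_liftFun (f : 𝒜 →⋆ₐ[ℂ] B) : Continuous (liftFun f) :=
  UniformSpace.Completion.continuous_extension

theorem liftFun_of (hb : BddAbove {p : Seminorm ℂ 𝒜 | IsCStarSeminorm p})
    (f : 𝒜 →⋆ₐ[ℂ] B) (a : 𝒜) : liftFun f (of 𝒜 a) = f a := by
  let g : MaxSeminormed 𝒜 →+ B := (f.toAlgHom.toLinearMap.toAddMonoidHom : 𝒜 →+ B)
  -- The function `‖f ·‖` is a C*-seminorm, hence lies below the largest one; finiteness of the
  -- supremum enters here.
  have hg : UniformContinuous g :=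
    AddMonoidHomClass.uniformContinuous_of_bound g 1 fun x => by
      rw [one_mul]
      exact le_csSup hb ((IsCStarSeminorm.norm B).comp f) x
  exact UniformSpace.Completion.extension_coe (α := MaxSeminormed 𝒜) (f := g) hg a

/-- The universal property of the enveloping C*-algebra. -/
def lift (hb : BddAbove {p : Seminorm ℂ 𝒜 | IsCStarSeminorm p}) (f : 𝒜 →⋆ₐ[ℂ] B) :
    CStarEnvelope 𝒜 →⋆ₐ[ℂ] B where
  toFun := liftFun f
  map_one' := by rw [← map_one (of 𝒜), liftFun_of hb, map_one]
  map_zero' := by rw [← map_zero (of 𝒜), liftFun_of hb, map_zero]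
  map_mul' x y := by
    have hc := continuous_liftFun f
    refine denseRange_of.induction_on₂ (p := fun x y => liftFun f (x * y) = liftFun f x * liftFun f y)
      (isClosed_eq
      (hc.comp (continuous_fst.mul continuous_snd))
      ((hc.comp continuous_fst).mul (hc.comp continuous_snd))) (fun a b => ?_) x y
    rw [← map_mul, liftFun_of hb, liftFun_of hb, liftFun_of hb, map_mul]
  map_add' x y := by
    have hc := continuous_liftFun f
    refine denseRange_of.induction_on₂ (p := fun x y => liftFun f (x + y) = liftFun f x + liftFun f y)
      (isClosed_eq
      (hc.comp (continuous_fst.add continuous_snd))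
      ((hc.comp continuous_fst).add (hc.comp continuous_snd))) (fun a b => ?_) x y
    rw [← map_add, liftFun_of hb, liftFun_of hb, liftFun_of hb, map_add]
  commutes' c := by rw [← AlgHomClass.commutes (of 𝒜), liftFun_of hb, AlgHomClass.commutes]
  map_star' x := by
    have hc := continuous_liftFun f
    refine denseRange_of.induction_on (p := fun x => liftFun f (star x) = star (liftFun f x)) x
      (isClosed_eq
      (hc.comp (continuous_star 𝒜)) hc.star) fun a => ?_
    rw [← map_star, liftFun_of hb, liftFun_of hb, map_star]

theorem lift_of (hb : BddAbove {p : Seminorm ℂ 𝒜 | IsCStarSeminorm p}) (f : 𝒜 →⋆ₐ[ℂ] B)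
    (a : 𝒜) : lift hb f (of 𝒜 a) = f a := liftFun_of hb f a

theorem mul_comm_of_forall (h : ∀ a b : 𝒜, a * b = b * a) (x y : CStarEnvelope 𝒜) :
    x * y = y * x := by
  refine denseRange_of.induction_on₂ (p := fun x y => x * y = y * x) (isClosed_eq
    (continuous_fst.mul continuous_snd) (continuous_snd.mul continuous_fst)) (fun a b => ?_) x y
  rw [← map_mul, ← map_mul, h]

variable [StarModule ℂ 𝒜]

theorem starAlgHom_ext {f g : CStarEnvelope 𝒜 →⋆ₐ[ℂ] B} (h : ∀ a, f (of 𝒜 a) = g (of 𝒜 a)) :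
    f = g :=
  DFunLike.coe_injective <| denseRange_of.equalizer (starAlgHom_continuous f)
    (starAlgHom_continuous g) (funext h)

/-- An element commuting with the image of `𝒜` commutes with the image of its envelope. -/
theorem commute_of_forall (f : CStarEnvelope 𝒜 →⋆ₐ[ℂ] B) {y : B}
    (h : ∀ a, Commute (f (of 𝒜 a)) y) (x : CStarEnvelope 𝒜) : Commute (f x) y := by
  have hc := starAlgHom_continuous f
  exact denseRange_of.induction_on (p := fun x => f x * y = y * f x) x
    (isClosed_eq (hc.mul_const y) (hc.const_mul y)) h

end CStarEnvelope

/-! ## Generators and homomorphisms of the algebra of quantum permutations -/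

namespace QPerm

variable {ι : Type*} [Fintype ι] {B : Type*} [Ring B] [Algebra ℂ B]

/-- The universal property gives a homomorphism into `S` whose composite with the inclusion fixes
the generators, hence is the identity. This serves as the induction principle for `QPerm`. -/
theorem mem_of_u_mem (S : Subalgebra ℂ (QPerm ι)) (h : ∀ i j, u i j ∈ S) (x : QPerm ι) :
    x ∈ S := by
  have hu := isMagic_u (ι := ι)
  have hm : IsMagic fun i j => (⟨u i j, h i j⟩ : S) :=
    ⟨fun i j => Subtype.ext (hu.idem i j), fun i j k hjk => Subtype.ext (hu.row_orth i j k hjk),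
      fun i j k hik => Subtype.ext (hu.col_orth i j k hik),
      fun i => Subtype.ext (by simpa using hu.row_sum i),
      fun j => Subtype.ext (by simpa using hu.col_sum j)⟩
  have hid : S.val.comp (lift _ hm) = AlgHom.id ℂ _ := algHom_ext fun i j => by
    rw [AlgHom.comp_apply, lift_u]
    rfl
  have hx := DFunLike.congr_fun hid x
  rw [AlgHom.id_apply] at hx
  rw [← hx]
  exact (lift _ hm x).2

theorem surjective_of_u_mem_range {κ : Type*} [Fintype κ] {f : B →ₐ[ℂ] QPerm κ}
    (h : ∀ i j, u i j ∈ f.range) : Function.Surjective f :=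
  fun x => mem_of_u_mem f.range h x

/-- An algebra homomorphism mapping the generators to self-adjoint elements is a
*-homomorphism. -/
theorem map_star_of_isSelfAdjoint [StarRing B] [StarModule ℂ B] (f : QPerm ι →ₐ[ℂ] B)
    (h : ∀ i j, IsSelfAdjoint (f (u i j))) (x : QPerm ι) : f (star x) = star (f x) := by
  let S : Subalgebra ℂ (QPerm ι) :=
    { carrier := {x | f (star x) = star (f x)}
      mul_mem' := fun {a b} ha hb => by
        simp only [Set.mem_ofPred_eq] at ha hb ⊢
        rw [star_mul, map_mul, ha, hb, map_mul, star_mul]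
      add_mem' := fun {a b} ha hb => by
        simp only [Set.mem_ofPred_eq] at ha hb ⊢
        rw [star_add, map_add, ha, hb, map_add, star_add]
      algebraMap_mem' := fun c => by
        simp only [Set.mem_ofPred_eq]
        rw [← algebraMap_star_comm, AlgHom.commutes, AlgHom.commutes, algebraMap_star_comm] }
  refine mem_of_u_mem S (fun i j => ?_) x
  change f (star (u i j)) = star (f (u i j))
  rw [star_u, (h i j).star_eq]

end QPerm

/-! ## Hopf ideals and Hopf images -/

theorem mul_comm_tensorProduct {A B : Type*} [Ring A] [Algebra ℂ A] [Ring B] [Algebra ℂ B]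
    (hA : ∀ x y : A, x * y = y * x) (hB : ∀ x y : B, x * y = y * x) (s t : A ⊗[ℂ] B) :
    s * t = t * s := by
  induction s using TensorProduct.induction_on with
  | zero => simp
  | add x y hx hy => rw [add_mul, mul_add, hx, hy]
  | tmul a b =>
    induction t using TensorProduct.induction_on with
    | zero => simp
    | add x y hx hy => rw [add_mul, mul_add, hx, hy]
    | tmul c d =>
      rw [Algebra.TensorProduct.tmul_mul_tmul, Algebra.TensorProduct.tmul_mul_tmul, hA, hB]

/-- The kernel of a tensor product of two surjective linear maps. -/
theorem mem_span_of_tensorMap_eq_zero {V W : Type*} [AddCommGroup V] [Module ℂ V]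
    [AddCommGroup W] [Module ℂ W] {f : V →ₗ[ℂ] W} (hf : Function.Surjective f)
    {t : V ⊗[ℂ] V} (ht : TensorProduct.map f f t = 0) :
    t ∈ Submodule.span ℂ {t : V ⊗[ℂ] V | ∃ a b, (f a = 0 ∨ f b = 0) ∧ t = a ⊗ₜ[ℂ] b} := by
  have hex : Function.Exact f.ker.subtype f := fun x => by simp
  have ht' : t ∈ (TensorProduct.map f f).ker := ht
  -- Right exactness: the kernel of `f ⊗ f` is the sum of the images of `V ⊗ ker f` and `ker f ⊗ V`.
  rw [TensorProduct.map_ker hex hf hex hf] at ht'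
  refine (sup_le ?_ ?_ : _ ≤ Submodule.span ℂ _) ht'
  · rintro _ ⟨s, rfl⟩
    induction s using TensorProduct.induction_on with
    | zero => simp
    | add x y hx hy => rw [map_add]; exact add_mem hx hy
    | tmul a b => exact Submodule.subset_span ⟨a, b, Or.inr b.2, rfl⟩
  · rintro _ ⟨s, rfl⟩
    induction s using TensorProduct.induction_on with
    | zero => simp
    | add x y hx hy => rw [map_add]; exact add_mem hx hy
    | tmul a b => exact Submodule.subset_span ⟨a, b, Or.inl a.2, rfl⟩

section Hopf

variable {ι : Type*} [Fintype ι] [DecidableEq ι] {B : Type*} [Ring B] [Algebra ℂ B]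

/-- Surjectivity of `ψ` makes the kernel of `ψ ⊗ ψ` equal to `J ⊗ 𝒜 + 𝒜 ⊗ J`, so the coideal
condition becomes the vanishing of `(ψ ⊗ ψ) ∘ Δ` on `J`. -/
theorem isHopfStarIdeal_of_surjective {J : TwoSidedIdeal (QPerm ι)} (ψ : QPerm ι →ₐ[ℂ] B)
    (hJ : ∀ x, x ∈ J ↔ ψ x = 0) (hψ : Function.Surjective ψ)
    (hΔ : ∀ x ∈ J, Algebra.TensorProduct.map ψ ψ (QPerm.comul x) = 0)
    (hε : ∀ x ∈ J, QPerm.counit x = 0) (hS : ∀ x ∈ J, ψ (QPerm.antipode x).unop = 0)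
    (hstar : ∀ x ∈ J, ψ (star x) = 0) : IsHopfStarIdeal J where
  comul_mem x hx := by
    simp only [hJ]
    exact mem_span_of_tensorMap_eq_zero (f := ψ.toLinearMap) hψ (hΔ x hx)
  counit_eq_zero := hε
  antipode_mem x hx := (hJ _).mpr (hS x hx)
  star_mem x hx := (hJ _).mpr (hstar x hx)

theorem IsHopfStarIdeal.tensorMap_comul_eq_zero {J : TwoSidedIdeal (QPerm ι)}
    (hJ : IsHopfStarIdeal J) {A : Type*} [Ring A] [Algebra ℂ A] (f : QPerm ι →ₐ[ℂ] A)
    (g : QPerm ι →ₐ[ℂ] B) (hf : ∀ x ∈ J, f x = 0) (hg : ∀ x ∈ J, g x = 0) {x : QPerm ι}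
    (hx : x ∈ J) : Algebra.TensorProduct.map f g (QPerm.comul x) = 0 := by
  have h : Submodule.span ℂ {t : QPerm ι ⊗[ℂ] QPerm ι | ∃ a b, (a ∈ J ∨ b ∈ J) ∧ t = a ⊗ₜ[ℂ] b} ≤
      (Algebra.TensorProduct.map f g).toLinearMap.ker := by
    rw [Submodule.span_le]
    rintro _ ⟨a, b, hab, rfl⟩
    rw [SetLike.mem_coe, LinearMap.mem_ker, AlgHom.toLinearMap_apply,
      Algebra.TensorProduct.map_tmul]
    rcases hab with h | h
    · rw [hf a h, TensorProduct.zero_tmul]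
    · rw [hg b h, TensorProduct.tmul_zero]
  exact h (hJ.comul_mem x hx)

variable (π : QPerm ι →ₐ[ℂ] B)

theorem le_hopfKernel {J : TwoSidedIdeal (QPerm ι)} (hJ : IsHopfStarIdeal J)
    (h : ∀ x ∈ J, π x = 0) : J ≤ hopfKernel π := le_sSup ⟨hJ, h⟩

/-- The Hopf kernel is only given as a supremum; since `ker f` is a two-sided ideal, vanishing can
be tested on each Hopf *-ideal separately. -/
theorem hopfKernel_le_ker {C : Type*} [Ring C] [Algebra ℂ C] (f : QPerm ι →ₐ[ℂ] C)
    (h : ∀ J, IsHopfStarIdeal J → (∀ x ∈ J, π x = 0) → ∀ x ∈ J, f x = 0)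
    {x : QPerm ι} (hx : x ∈ hopfKernel π) : f x = 0 := by
  have hle : hopfKernel π ≤ TwoSidedIdeal.ker f := sSup_le fun J hJ y hy =>
    (TwoSidedIdeal.mem_ker f).mpr (h J hJ.1 hJ.2 y hy)
  exact (TwoSidedIdeal.mem_ker f).mp (hle hx)

theorem apply_eq_zero_of_mem_hopfKernel {x : QPerm ι} (hx : x ∈ hopfKernel π) : π x = 0 :=
  hopfKernel_le_ker π π (fun _ _ h => h) hx

namespace HopfImage

theorem mk_eq_zero_iff {x : QPerm ι} : mk π x = 0 ↔ x ∈ hopfKernel π := by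
  have h0 : mk π x = 0 ↔ (hopfKernel π).ringCon x 0 := (hopfKernel π).ringCon.eq
  rw [h0, TwoSidedIdeal.rel_iff, sub_zero]

variable {C : Type*} [Ring C] [Algebra ℂ C]

/-- A homomorphism vanishing on the Hopf kernel factors through the Hopf image. -/
def lift (f : QPerm ι →ₐ[ℂ] C) (hf : ∀ x ∈ hopfKernel π, f x = 0) : HopfImage π →ₐ[ℂ] C :=
  (hopfKernel π).ringCon.liftₐ f fun x y hxy => by
    have h := hf _ (((hopfKernel π).rel_iff x y).mp hxy)
    rw [map_sub, sub_eq_zero] at h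
    exact h

@[simp]
theorem lift_mk (f : QPerm ι →ₐ[ℂ] C) (hf : ∀ x ∈ hopfKernel π, f x = 0) (x : QPerm ι) :
    lift π f hf (mk π x) = f x := rfl

variable {π} in
theorem algHom_ext {f g : HopfImage π →ₐ[ℂ] C}
    (h : ∀ i j, f (mk π (QPerm.u i j)) = g (mk π (QPerm.u i j))) : f = g := by
  have hc : f.comp (mk π) = g.comp (mk π) := QPerm.algHom_ext h
  refine AlgHom.ext fun x => ?_
  obtain ⟨x, rfl⟩ := mk_surjective π x
  exact DFunLike.congr_fun hc x

theorem star_mk_u (i j : ι) : star (mk π (QPerm.u i j)) = mk π (QPerm.u i j) := by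
  rw [← mk_star, QPerm.star_u]

/-- An algebra homomorphism mapping the generators to self-adjoint elements, as a
*-homomorphism. -/
def toStarAlgHom [StarRing C] [StarModule ℂ C] (f : HopfImage π →ₐ[ℂ] C)
    (h : ∀ i j, IsSelfAdjoint (f (mk π (QPerm.u i j)))) : HopfImage π →⋆ₐ[ℂ] C where
  __ := f
  map_star' x := by
    obtain ⟨x, rfl⟩ := mk_surjective π x
    exact QPerm.map_star_of_isSelfAdjoint (f.comp (mk π)) h x

@[simp]
theorem toStarAlgHom_apply [StarRing C] [StarModule ℂ C] (f : HopfImage π →ₐ[ℂ] C)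
    (h : ∀ i j, IsSelfAdjoint (f (mk π (QPerm.u i j)))) (x : HopfImage π) :
    toStarAlgHom π f h x = f x := rfl

/-- The bounded elements form a subalgebra containing the generators, which are projections. -/
theorem bddAbove_isCStarSeminorm :
    BddAbove {p : Seminorm ℂ (HopfImage π) | IsCStarSeminorm p} := by
  refine IsCStarSeminorm.bddAbove_of_forall fun x => ?_
  obtain ⟨x, rfl⟩ := mk_surjective π x
  refine QPerm.mem_of_u_mem ((IsCStarSeminorm.boundedElements (HopfImage π)).comap (mk π))
    (fun i j => ⟨1, fun p hp => hp.le_one_of_isStarProjection ⟨?_, ?_⟩⟩) x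
  · change mk π _ * mk π _ = mk π _
    rw [← map_mul, QPerm.isMagic_u.idem]
  · exact star_mk_u π i j

/-- Comultiplication of the Hopf image. -/
def comul : HopfImage π →ₐ[ℂ] HopfImage π ⊗[ℂ] HopfImage π :=
  lift π ((Algebra.TensorProduct.map (mk π) (mk π)).comp QPerm.comul) fun _ hx =>
    hopfKernel_le_ker π _ (fun J hJ h y hy => by
      have hm : ∀ z ∈ J, mk π z = 0 := fun z hz => (mk_eq_zero_iff π).mpr (le_hopfKernel π hJ h hz)
      exact hJ.tensorMap_comul_eq_zero _ _ hm hm hy) hx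

/-- Counit of the Hopf image. -/
def counit : HopfImage π →ₐ[ℂ] ℂ :=
  lift π QPerm.counit fun _ hx =>
    hopfKernel_le_ker π _ (fun _ hJ _ y hy => hJ.counit_eq_zero y hy) hx

/-- Antipode of the Hopf image. -/
def antipode : HopfImage π →ₐ[ℂ] (HopfImage π)ᵐᵒᵖ :=
  lift π ((AlgHom.op (mk π)).comp QPerm.antipode) fun _ hx =>
    hopfKernel_le_ker π _ (fun _ hJ h y hy => congrArg MulOpposite.op <|
      (mk_eq_zero_iff π).mpr (le_hopfKernel π hJ h (hJ.antipode_mem y hy))) hx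

theorem comul_u (i j : ι) : comul π (mk π (QPerm.u i j)) =
    ∑ k, mk π (QPerm.u i k) ⊗ₜ[ℂ] mk π (QPerm.u k j) := by
  rw [comul, lift_mk, AlgHom.comp_apply, QPerm.comul, QPerm.lift_u, map_sum]
  simp

theorem counit_u (i j : ι) : counit π (mk π (QPerm.u i j)) = if i = j then 1 else 0 := by
  rw [counit, lift_mk, QPerm.counit, QPerm.lift_u]

theorem antipode_u (i j : ι) :
    antipode π (mk π (QPerm.u i j)) = MulOpposite.op (mk π (QPerm.u j i)) := by
  rw [antipode, lift_mk, AlgHom.comp_apply, QPerm.antipode, QPerm.lift_u]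
  rfl

end HopfImage

/-- The structure maps descend to the Hopf image, because they respect each ideal in the supremum;
their compatibility with `mk` gives the Hopf conditions for its kernel. -/
theorem isHopfStarIdeal_hopfKernel : IsHopfStarIdeal (hopfKernel π) := by
  refine isHopfStarIdeal_of_surjective (HopfImage.mk π)
    (fun x => (HopfImage.mk_eq_zero_iff π).symm) (HopfImage.mk_surjective π)
    (fun x hx => ?_) (fun x hx => ?_) (fun x hx => ?_)
    fun x hx => (HopfImage.mk_eq_zero_iff π).mpr (star_mem_hopfKernel π hx)
  · have h := congrArg (HopfImage.comul π) ((HopfImage.mk_eq_zero_iff π).mpr hx)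
    rwa [map_zero] at h
  · have h := congrArg (HopfImage.counit π) ((HopfImage.mk_eq_zero_iff π).mpr hx)
    rwa [map_zero] at h
  · have h := congrArg (HopfImage.antipode π) ((HopfImage.mk_eq_zero_iff π).mpr hx)
    rw [map_zero] at h
    exact congrArg MulOpposite.unop h

/-- The kernel of a surjection onto an algebra carrying compatible structure maps is a Hopf
*-ideal. -/
theorem isHopfStarIdeal_ker [StarRing B] [StarModule ℂ B] (hπ : Function.Surjective π)
    (hsa : ∀ i j, IsSelfAdjoint (π (QPerm.u i j)))
    (Δ : B →ₐ[ℂ] B ⊗[ℂ] B)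
    (hΔ : ∀ i j, Δ (π (QPerm.u i j)) = ∑ k, π (QPerm.u i k) ⊗ₜ[ℂ] π (QPerm.u k j))
    (ε : B →ₐ[ℂ] ℂ) (hε : ∀ i j, ε (π (QPerm.u i j)) = if i = j then 1 else 0)
    (S : B →ₐ[ℂ] Bᵐᵒᵖ) (hS : ∀ i j, S (π (QPerm.u i j)) = MulOpposite.op (π (QPerm.u j i))) :
    IsHopfStarIdeal (TwoSidedIdeal.ker π) := by
  have h1 : Δ.comp π = (Algebra.TensorProduct.map π π).comp QPerm.comul :=
    QPerm.algHom_ext fun i j => by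
      rw [AlgHom.comp_apply, AlgHom.comp_apply, hΔ, QPerm.comul, QPerm.lift_u, map_sum]
      simp
  have h2 : ε.comp π = QPerm.counit := QPerm.algHom_ext fun i j => by
      rw [AlgHom.comp_apply, hε, QPerm.counit, QPerm.lift_u]
  have h3 : S.comp π = (AlgHom.op π).comp QPerm.antipode := QPerm.algHom_ext fun i j => by
      rw [AlgHom.comp_apply, AlgHom.comp_apply, hS, QPerm.antipode, QPerm.lift_u]
      rfl
  refine isHopfStarIdeal_of_surjective π (fun x => TwoSidedIdeal.mem_ker π) hπ
    (fun x hx => ?_) (fun x hx => ?_) (fun x hx => ?_) fun x hx => ?_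
  all_goals rw [TwoSidedIdeal.mem_ker] at hx
  · have h := DFunLike.congr_fun h1 x
    rw [AlgHom.comp_apply, hx, map_zero] at h
    exact h.symm
  · rw [← h2, AlgHom.comp_apply, hx, map_zero]
  · have h := DFunLike.congr_fun h3 x
    rw [AlgHom.comp_apply, hx, map_zero] at h
    exact (congrArg MulOpposite.unop h).symm
  · rw [QPerm.map_star_of_isSelfAdjoint π hsa, hx, star_zero]

/-- Surjective Hopf *-algebra homomorphisms preserve the Hopf kernels. -/
theorem map_mem_hopfKernel {κ : Type*} [Fintype κ] [DecidableEq κ] {C : Type*} [Ring C]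
    [Algebra ℂ C] (ρ : QPerm κ →ₐ[ℂ] C) (p : QPerm ι →ₐ[ℂ] QPerm κ)
    (hp : Function.Surjective p) (hsa : ∀ i j, IsSelfAdjoint (p (QPerm.u i j)))
    (hΔ : ∀ i j, QPerm.comul (p (QPerm.u i j)) = ∑ k, p (QPerm.u i k) ⊗ₜ[ℂ] p (QPerm.u k j))
    (hε : ∀ i j, QPerm.counit (p (QPerm.u i j)) = if i = j then 1 else 0)
    (hS : ∀ i j, QPerm.antipode (p (QPerm.u i j)) = MulOpposite.op (p (QPerm.u j i)))
    (hker : ∀ x ∈ hopfKernel π, ρ (p x) = 0) {x : QPerm ι} (hx : x ∈ hopfKernel π) :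
    p x ∈ hopfKernel ρ := by
  have hJ := isHopfStarIdeal_hopfKernel π
  have h1 : QPerm.comul.comp p = (Algebra.TensorProduct.map p p).comp QPerm.comul :=
    QPerm.algHom_ext fun i j => by
      rw [AlgHom.comp_apply, AlgHom.comp_apply, hΔ, QPerm.comul, QPerm.lift_u, map_sum]
      simp
  have h2 : QPerm.counit.comp p = QPerm.counit := QPerm.algHom_ext fun i j => by
      rw [AlgHom.comp_apply, hε, QPerm.counit, QPerm.lift_u]
  have h3 : QPerm.antipode.comp p = (AlgHom.op p).comp QPerm.antipode :=
    QPerm.algHom_ext fun i j => by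
      rw [AlgHom.comp_apply, AlgHom.comp_apply, hS, QPerm.antipode, QPerm.lift_u]
      rfl
  -- As `p` is onto, the image of the Hopf kernel is an ideal, and it inherits the Hopf conditions
  -- from compatibility of `p` with the structure maps. It is killed by `ρ`, hence lies in the
  -- largest such ideal.
  let K : TwoSidedIdeal (QPerm κ) := TwoSidedIdeal.mk' (p '' hopfKernel π)
    ⟨0, zero_mem _, map_zero p⟩
    (by
      rintro _ _ ⟨x, hx, rfl⟩ ⟨y, hy, rfl⟩
      exact ⟨x + y, add_mem hx hy, map_add p x y⟩)
    (by
      rintro _ ⟨x, hx, rfl⟩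
      exact ⟨-x, neg_mem hx, map_neg p x⟩)
    (by
      rintro a _ ⟨y, hy, rfl⟩
      obtain ⟨a, rfl⟩ := hp a
      exact ⟨a * y, (hopfKernel π).mul_mem_left _ _ hy, map_mul p a y⟩)
    (by
      rintro _ b ⟨y, hy, rfl⟩
      obtain ⟨b, rfl⟩ := hp b
      exact ⟨y * b, (hopfKernel π).mul_mem_right _ _ hy, map_mul p y b⟩)
  have hmem : ∀ y, y ∈ K ↔ ∃ z ∈ hopfKernel π, p z = y := fun y =>
    TwoSidedIdeal.mem_mk' ..
  have hK : IsHopfStarIdeal K := by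
    refine ⟨fun y hy => ?_, fun y hy => ?_, fun y hy => ?_, fun y hy => ?_⟩
    all_goals obtain ⟨z, hz, rfl⟩ := (hmem y).mp hy
    · have e := DFunLike.congr_fun h1 z
      rw [AlgHom.comp_apply, AlgHom.comp_apply] at e
      rw [e]
      have := Submodule.mem_map_of_mem (f := (Algebra.TensorProduct.map p p).toLinearMap)
        (hJ.comul_mem z hz)
      rw [Submodule.map_span] at this
      refine Submodule.span_mono ?_ this
      rintro _ ⟨_, ⟨a, b, hab, rfl⟩, rfl⟩
      exact ⟨p a, p b, hab.imp (fun h => (hmem _).mpr ⟨a, h, rfl⟩)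
        fun h => (hmem _).mpr ⟨b, h, rfl⟩, by simp⟩
    · have e := DFunLike.congr_fun h2 z
      rw [AlgHom.comp_apply] at e
      rw [e, hJ.counit_eq_zero z hz]
    · have e := DFunLike.congr_fun h3 z
      rw [AlgHom.comp_apply, AlgHom.comp_apply] at e
      rw [e]
      exact (hmem _).mpr ⟨_, hJ.antipode_mem z hz, rfl⟩
    · exact (hmem _).mpr ⟨_, hJ.star_mem z hz, QPerm.map_star_of_isSelfAdjoint p hsa z⟩
  refine le_hopfKernel ρ hK (fun y hy => ?_) ((hmem _).mpr ⟨x, hx, rfl⟩)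
  obtain ⟨z, hz, rfl⟩ := (hmem y).mp hy
  exact hker z hz

variable (ι) in
/-- The commutator ideal of the algebra of quantum permutations. -/
def commutatorIdeal : TwoSidedIdeal (QPerm ι) :=
  TwoSidedIdeal.span {z | ∃ x y, z = x * y - y * x}

theorem apply_eq_zero_of_mem_commutatorIdeal (hπ : ∀ x y, π x * π y = π y * π x) (x : QPerm ι)
    (hx : x ∈ commutatorIdeal ι) : π x = 0 := by
  have : commutatorIdeal ι ≤ TwoSidedIdeal.ker π := TwoSidedIdeal.span_le.mpr (by
    rintro _ ⟨x, y, rfl⟩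
    rw [SetLike.mem_coe, TwoSidedIdeal.mem_ker, map_sub, map_mul, map_mul, hπ, sub_self])
  exact (TwoSidedIdeal.mem_ker π).mp (this hx)

variable (ι) in
-- The quotient `q` by commutators is commutative, and so are its tensor square and its opposite.
-- Thus `(q ⊗ q) ∘ Δ`, `ε` and `q ∘ S` kill commutators. The adjoint of a commutator is a
-- commutator.
theorem isHopfStarIdeal_commutatorIdeal : IsHopfStarIdeal (commutatorIdeal ι) := by
  let J := commutatorIdeal ι
  let q : QPerm ι →ₐ[ℂ] J.ringCon.Quotient := { J.ringCon.mk' with commutes' := fun _ => rfl }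
  have hq : Function.Surjective q := J.ringCon.mk'_surjective
  have hqJ : ∀ x, x ∈ J ↔ q x = 0 := fun x => by
    have h0 : q x = 0 ↔ J.ringCon x 0 := J.ringCon.eq
    rw [h0, TwoSidedIdeal.rel_iff, sub_zero]
  have hcomm : ∀ x y : J.ringCon.Quotient, x * y = y * x := fun x y => by
    obtain ⟨x, rfl⟩ := hq x
    obtain ⟨y, rfl⟩ := hq y
    rw [← sub_eq_zero, ← map_mul, ← map_mul, ← map_sub, ← hqJ]
    exact TwoSidedIdeal.subset_span ⟨x, y, rfl⟩
  have hstar : J ≤ TwoSidedIdeal.mk' {x | star x ∈ J} (by simp)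
      (fun {x y} hx hy => by simpa using J.add_mem hx hy)
      (fun {x} hx => by simpa using J.neg_mem hx)
      (fun {x y} hy => by simpa using J.mul_mem_right _ _ hy)
      (fun {x y} hx => by simpa using J.mul_mem_left _ _ hx) := TwoSidedIdeal.span_le.mpr (by
    rintro _ ⟨x, y, rfl⟩
    rw [SetLike.mem_coe, TwoSidedIdeal.mem_mk']
    exact TwoSidedIdeal.subset_span ⟨star y, star x, by simp⟩)
  refine isHopfStarIdeal_of_surjective q hqJ hq (fun x hx => ?_) (fun x hx => ?_)
    (fun x hx => ?_) fun x hx => ?_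
  · exact apply_eq_zero_of_mem_commutatorIdeal ((Algebra.TensorProduct.map q q).comp QPerm.comul)
      (fun _ _ => mul_comm_tensorProduct hcomm hcomm _ _) x hx
  · exact apply_eq_zero_of_mem_commutatorIdeal QPerm.counit (fun _ _ => mul_comm _ _) x hx
  · exact congrArg MulOpposite.unop (apply_eq_zero_of_mem_commutatorIdeal
      ((AlgHom.op q).comp QPerm.antipode) (fun _ _ => MulOpposite.unop_injective (hcomm _ _)) x hx)
  · rw [← hqJ]
    simpa using hstar hx

/-- The Hopf image of a representation with commutative range is commutative. -/
theorem HopfImage.mul_comm_of_commute (hπ : ∀ x y, π x * π y = π y * π x) (x y : HopfImage π) :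
    x * y = y * x := by
  obtain ⟨x, rfl⟩ := mk_surjective π x
  obtain ⟨y, rfl⟩ := mk_surjective π y
  rw [← sub_eq_zero, ← map_mul, ← map_mul, ← map_sub, mk_eq_zero_iff]
  exact le_hopfKernel π (isHopfStarIdeal_commutatorIdeal ι)
    (apply_eq_zero_of_mem_commutatorIdeal π hπ) (TwoSidedIdeal.subset_span ⟨x, y, rfl⟩)

end Hopf

/-! ## The representation associated with a Hadamard matrix -/

section HadamardRep

variable {ι : Type*} [Fintype ι] [DecidableEq ι] {h : Matrix ι ι ℂ}

theorem Matrix.IsHadamard.apply_mul_star (hh : h.IsHadamard) (i k : ι) :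
    h i k * star (h i k) = 1 := (Unitary.mem_iff.mp (hh.apply_mem i k)).2

theorem Matrix.IsHadamard.apply_ne_zero (hh : h.IsHadamard) (i k : ι) : h i k ≠ 0 :=
  left_ne_zero_of_mul_eq_one (hh.apply_mul_star i k)

theorem Matrix.IsHadamard.inv_apply (hh : h.IsHadamard) (i k : ι) :
    (h i k)⁻¹ = star (h i k) := inv_eq_of_mul_eq_one_right (hh.apply_mul_star i k)

theorem Matrix.IsHadamard.sum_apply_mul_star (hh : h.IsHadamard) (i j : ι) :
    ∑ k, h i k * star (h j k) = if i = j then (Fintype.card ι : ℂ) else 0 := by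
  have := congrFun (congrFun hh.mul_conjTranspose i) j
  simpa [Matrix.mul_apply, Matrix.one_apply] using this

theorem magicBasis_apply (hh : h.IsHadamard) (i j k : ι) :
    magicBasis h i j k = h j k * star (h i k) := by
  rw [magicBasis, Pi.div_apply, div_eq_mul_inv, hh.inv_apply]

theorem star_magicBasis_dotProduct_self (hh : h.IsHadamard) (i j : ι) :
    star (magicBasis h i j) ⬝ᵥ magicBasis h i j = Fintype.card ι := by
  have hk : ∀ k, star (magicBasis h i j) k * magicBasis h i j k = 1 := fun k => by
    rw [Pi.star_apply, magicBasis_apply hh, star_mul, star_star]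
    calc h i k * star (h j k) * (h j k * star (h i k))
        = (h i k * star (h i k)) * (h j k * star (h j k)) := by ring
      _ = 1 := by rw [hh.apply_mul_star, hh.apply_mul_star, one_mul]
  simp only [dotProduct, hk, Finset.sum_const, Finset.card_univ, nsmul_eq_mul, mul_one]

theorem lineProjection_magicBasis_apply (hh : h.IsHadamard) (i j k l : ι) :
    lineProjection (magicBasis h i j) k l =
      (Fintype.card ι : ℂ)⁻¹ * (magicBasis h i j k * star (magicBasis h i j l)) := by
  rw [lineProjection, star_magicBasis_dotProduct_self hh]
  rfl

theorem hadamardRep_u (hh : h.IsHadamard) (i j : ι) :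
    hadamardRep hh (QPerm.u i j) = lineProjection (magicBasis h i j) := QPerm.lift_u ..

theorem isSelfAdjoint_hadamardRep_u (hh : h.IsHadamard) (i j : ι) :
    IsSelfAdjoint (hadamardRep hh (QPerm.u i j)) := by
  ext k l
  rw [Matrix.star_apply, hadamardRep_u, lineProjection_magicBasis_apply hh,
    lineProjection_magicBasis_apply hh]
  simp [mul_comm]

theorem HadamardAlgebra.isSelfAdjoint_u (hh : h.IsHadamard) (i j : ι) :
    IsSelfAdjoint (HadamardAlgebra.u hh i j) := by
  rw [isSelfAdjoint_iff, HadamardAlgebra.u, ← map_star, HopfImage.star_mk_u]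

theorem HadamardAlgebra.starAlgHom_ext {hh : h.IsHadamard} {B : Type*} [CStarAlgebra B]
    {f g : HadamardAlgebra hh →⋆ₐ[ℂ] B}
    (hfg : ∀ i j, f (HadamardAlgebra.u hh i j) = g (HadamardAlgebra.u hh i j)) : f = g := by
  have hc : f.toAlgHom.comp (CStarEnvelope.of _).toAlgHom =
      g.toAlgHom.comp (CStarEnvelope.of _).toAlgHom := HopfImage.algHom_ext hfg
  exact CStarEnvelope.starAlgHom_ext fun a => DFunLike.congr_fun hc a

end HadamardRep

/-! ## Fourier matrices -/

section Cyclic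

variable {n : ℕ}

/-- The coordinate function is the indicator of the point `i - j`. -/
theorem cyclicMagic_congr {i j i' j' : ZMod n} (h : i - j = i' - j') :
    cyclicMagic i j = cyclicMagic i' j' := by
  ext x
  have h1 : x + j = i ↔ x = i - j := eq_sub_iff_add_eq.symm
  have h2 : x + j' = i' ↔ x = i' - j' := eq_sub_iff_add_eq.symm
  simp [cyclicMagic, h1, h2, h]

theorem isSelfAdjoint_cyclicMagic (i j : ZMod n) : IsSelfAdjoint (cyclicMagic i j) := by
  ext x
  simp [cyclicMagic, apply_ite (starRingEnd ℂ)]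

variable [NeZero n]

theorem isMagic_cyclicMagic : IsMagic (cyclicMagic : ZMod n → ZMod n → C(ZMod n, ℂ)) := by
  refine ⟨fun i j => ?_, fun i j k hjk => ?_, fun i j k hik => ?_, fun i => ?_, fun j => ?_⟩
  · ext x
    simp [cyclicMagic]
  · ext x
    have : x + j = i → x + k ≠ i := fun h1 h2 => hjk (add_left_cancel (h1.trans h2.symm))
    simpa [cyclicMagic] using fun h2 h1 => this h1 h2
  · ext x
    have : x + j = i → x + j ≠ k := fun h1 h2 => hik (h1.symm.trans h2)
    simpa [cyclicMagic] using fun h2 h1 => this h1 h2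
  · ext x
    have : ∀ j, x + j = i ↔ j = i - x := fun j => by rw [eq_sub_iff_add_eq, add_comm]
    simp [cyclicMagic, ContinuousMap.sum_apply, this]
  · ext x
    simp [cyclicMagic, ContinuousMap.sum_apply]

variable (n) in
/-- The coordinates of the group `ℤ/n` of cyclic permutations. -/
def cyclicRep : QPerm (ZMod n) →ₐ[ℂ] C(ZMod n, ℂ) := QPerm.lift cyclicMagic isMagic_cyclicMagic

theorem cyclicRep_u (i j : ZMod n) : cyclicRep n (QPerm.u i j) = cyclicMagic i j :=
  QPerm.lift_u ..

theorem eq_sum_smul_cyclicMagic (f : C(ZMod n, ℂ)) : f = ∑ m, f m • cyclicMagic m 0 := by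
  ext x
  simp [cyclicMagic, ContinuousMap.sum_apply]

theorem cyclicRep_surjective : Function.Surjective (cyclicRep n) := fun f =>
  ⟨∑ m, f m • QPerm.u m 0, by
    simp only [map_sum, map_smul, cyclicRep_u, ← eq_sum_smul_cyclicMagic f]⟩

variable {B : Type*} [Ring B] [Algebra ℂ B]

/-- A homomorphism whose values on `u i j` depend on `i - j` only factors through the algebra of
functions on `ℤ/n`. -/
def cyclicFactor (f : QPerm (ZMod n) →ₐ[ℂ] B) : C(ZMod n, ℂ) →ₐ[ℂ] B :=
  AlgHom.ofLinearMap
    { toFun := fun g => ∑ m, g m • f (QPerm.u m 0)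
      map_add' := fun g g' => by simp [add_smul, Finset.sum_add_distrib]
      map_smul' := fun c g => by simp [mul_smul, Finset.smul_sum] }
    -- Column `0` of `u` consists of orthogonal idempotents with sum `1`, so this is a homomorphism
    -- for every `f`; dependence on `i - j` matters only for the factorization.
    (by simp [← map_sum, QPerm.isMagic_u.col_sum])
    (fun g g' => by
      have hmul : ∀ k l : ZMod n, f (QPerm.u k 0) * f (QPerm.u l 0) =
          if k = l then f (QPerm.u k 0) else 0 := fun k l => by
        rw [← map_mul]
        split_ifs with h
        · rw [← h, QPerm.isMagic_u.idem]
        · rw [QPerm.isMagic_u.col_orth _ _ _ h, map_zero]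
      simp [Finset.sum_mul, Finset.mul_sum, hmul, smul_smul, mul_comm])

theorem cyclicFactor_apply (f : QPerm (ZMod n) →ₐ[ℂ] B) (g : C(ZMod n, ℂ)) :
    cyclicFactor f g = ∑ m, g m • f (QPerm.u m 0) := rfl

theorem cyclicFactor_cyclicMagic (f : QPerm (ZMod n) →ₐ[ℂ] B)
    (hf : ∀ i j, f (QPerm.u i j) = f (QPerm.u (i - j) 0)) (i j : ZMod n) :
    cyclicFactor f (cyclicMagic i j) = f (QPerm.u i j) := by
  have : ∀ m, m + j = i ↔ m = i - j := fun m => eq_sub_iff_add_eq.symm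
  rw [cyclicFactor_apply, hf i j]
  simp [cyclicMagic, this]

theorem cyclicFactor_cyclicRep (f : QPerm (ZMod n) →ₐ[ℂ] B)
    (hf : ∀ i j, f (QPerm.u i j) = f (QPerm.u (i - j) 0)) (x : QPerm (ZMod n)) :
    cyclicFactor f (cyclicRep n x) = f x := by
  have : (cyclicFactor f).comp (cyclicRep n) = f := QPerm.algHom_ext fun i j => by
    rw [AlgHom.comp_apply, cyclicRep_u, cyclicFactor_cyclicMagic f hf]
  exact DFunLike.congr_fun this x

variable (n) in
-- Each structure map, composed down to functions on `ℤ/n`, takes values at `u i j` depending on `i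
-- - j` only, so `cyclicFactor` descends it. For `Δ` this is the reindexing `k ↦ k + j` of the sum.
theorem isHopfStarIdeal_ker_cyclicRep : IsHopfStarIdeal (TwoSidedIdeal.ker (cyclicRep n)) := by
  have hc : ∀ (i j : ZMod n), (∑ k, cyclicMagic i k ⊗ₜ[ℂ] cyclicMagic k j) =
      ∑ k, cyclicMagic (i - j) k ⊗ₜ[ℂ] cyclicMagic k 0 := fun i j => by
    refine (Fintype.sum_equiv (Equiv.addRight j) _ _ fun k => ?_).symm
    rw [Equiv.coe_addRight, cyclicMagic_congr (i := i - j) (j := k) (i' := i) (j' := k + j)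
      (by ring), cyclicMagic_congr (i := k) (j := 0) (i' := k + j) (j' := j) (by ring)]
  refine isHopfStarIdeal_ker (cyclicRep n) cyclicRep_surjective
    (fun i j => by rw [cyclicRep_u]; exact isSelfAdjoint_cyclicMagic i j)
    (cyclicFactor ((Algebra.TensorProduct.map (cyclicRep n) (cyclicRep n)).comp QPerm.comul))
    (fun i j => ?_) (cyclicFactor QPerm.counit) (fun i j => ?_)
    (cyclicFactor ((AlgHom.op (cyclicRep n)).comp QPerm.antipode)) (fun i j => ?_)
  · have hu : ∀ i j : ZMod n, (Algebra.TensorProduct.map (cyclicRep n) (cyclicRep n))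
        (QPerm.comul (QPerm.u i j)) = ∑ k, cyclicMagic i k ⊗ₜ[ℂ] cyclicMagic k j := fun i j => by
      rw [QPerm.comul, QPerm.lift_u, map_sum]
      simp [cyclicRep_u]
    rw [cyclicFactor_cyclicRep _ fun i j => ?_, AlgHom.comp_apply, hu]
    · simp [cyclicRep_u]
    · rw [AlgHom.comp_apply, AlgHom.comp_apply, hu, hu, hc]
  · rw [cyclicFactor_cyclicRep _ fun i j => ?_, QPerm.counit, QPerm.lift_u]
    rw [QPerm.counit, QPerm.lift_u, QPerm.lift_u]
    simp [sub_eq_zero]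
  · have hu : ∀ i j : ZMod n, (AlgHom.op (cyclicRep n)) (QPerm.antipode (QPerm.u i j)) =
        MulOpposite.op (cyclicMagic j i) := fun i j => by
      rw [QPerm.antipode, QPerm.lift_u, ← cyclicRep_u]
      rfl
    rw [cyclicFactor_cyclicRep _ fun i j => ?_, AlgHom.comp_apply, hu, cyclicRep_u]
    rw [AlgHom.comp_apply, AlgHom.comp_apply, hu, hu,
      cyclicMagic_congr (i := j) (j := i) (i' := 0) (j' := i - j) (by ring)]

theorem magicBasis_fourierMatrix (i j k : ZMod n) :
    magicBasis (fourierMatrix n) i j k = ZMod.stdAddChar ((j - i) * k) := by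
  rw [magicBasis, Pi.div_apply, fourierMatrix_apply, fourierMatrix_apply, sub_mul,
    AddChar.map_sub_eq_div]

theorem hadamardRep_fourierMatrix_u (i j : ZMod n) :
    hadamardRep (isHadamard_fourierMatrix n) (QPerm.u i j) =
      hadamardRep (isHadamard_fourierMatrix n) (QPerm.u (i - j) 0) := by
  rw [hadamardRep_u, hadamardRep_u]
  congr 1
  ext k
  rw [magicBasis_fourierMatrix, magicBasis_fourierMatrix, zero_sub, neg_sub]

variable (n) in
-- Here the representation has the same kernel as `cyclicRep`, so the largest Hopf *-ideal is that
-- whole kernel.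
theorem hopfKernel_fourierMatrix :
    hopfKernel (hadamardRep (isHadamard_fourierMatrix n)) = TwoSidedIdeal.ker (cyclicRep n) := by
  set π := hadamardRep (isHadamard_fourierMatrix n) with hπ
  have hf := hadamardRep_fourierMatrix_u (n := n)
  refine le_antisymm (fun x hx => ?_) (le_hopfKernel π (isHopfStarIdeal_ker_cyclicRep n)
    fun x hx => ?_)
  · have h0 := apply_eq_zero_of_mem_hopfKernel π hx
    rw [← cyclicFactor_cyclicRep π hf, cyclicFactor_apply] at h0
    rw [TwoSidedIdeal.mem_ker]
    ext m
    -- Multiplying by `π (u m 0)` isolates the coefficient at `m`; the `(0, 0)` entry of that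
    -- projection is `1 / n`.
    have h1 := congrArg (fun T => (T * π (QPerm.u m 0)) 0 0) h0
    have hmul : ∀ k, π (QPerm.u k 0) * π (QPerm.u m 0) =
        if k = m then π (QPerm.u m 0) else 0 := fun k => by
      rw [← map_mul]
      split_ifs with h
      · rw [h, QPerm.isMagic_u.idem]
      · rw [QPerm.isMagic_u.col_orth _ _ _ h, map_zero]
    have hne : π (QPerm.u m 0) 0 0 ≠ 0 := by
      rw [hπ, hadamardRep_u, lineProjection_magicBasis_apply (isHadamard_fourierMatrix n),
        magicBasis_fourierMatrix]
      simp [NeZero.ne n]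
    simp only [Finset.sum_mul, smul_mul_assoc, hmul, smul_ite, smul_zero, Finset.sum_ite_eq',
      Finset.mem_univ, if_true, zero_mul, Matrix.smul_apply, Matrix.zero_apply, smul_eq_mul] at h1
    exact (mul_eq_zero.mp h1).resolve_right hne
  · rw [← cyclicFactor_cyclicRep π hf, (TwoSidedIdeal.mem_ker _).mp hx, map_zero]

variable (n) in
/-- The quantum permutation algebra of the Fourier matrix is the algebra of functions on the
cyclic group. -/
theorem exists_hadamardAlgebra_fourierMatrix_equiv :
    ∃ φ : HadamardAlgebra (isHadamard_fourierMatrix n) ≃⋆ₐ[ℂ] C(ZMod n, ℂ),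
      ∀ i j, φ (HadamardAlgebra.u (isHadamard_fourierMatrix n) i j) = cyclicMagic i j := by
  set hh := isHadamard_fourierMatrix n
  set π := hadamardRep hh
  have hker := hopfKernel_fourierMatrix n
  let f₀ : HopfImage π →⋆ₐ[ℂ] C(ZMod n, ℂ) := HopfImage.toStarAlgHom π
    (HopfImage.lift π (cyclicRep n) fun x hx => (TwoSidedIdeal.mem_ker _).mp (hker.le hx))
    fun i j => by
      rw [HopfImage.lift_mk, cyclicRep_u]
      exact isSelfAdjoint_cyclicMagic i j
  let f : HadamardAlgebra hh →⋆ₐ[ℂ] C(ZMod n, ℂ) :=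
    CStarEnvelope.lift (HopfImage.bddAbove_isCStarSeminorm π) f₀
  have hfu : ∀ i j, f (HadamardAlgebra.u hh i j) = cyclicMagic i j := fun i j => by
    rw [← cyclicRep_u]
    exact CStarEnvelope.lift_of ..
  let m : QPerm (ZMod n) →ₐ[ℂ] HadamardAlgebra hh :=
    (CStarEnvelope.of _).toAlgHom.comp (HopfImage.mk π)
  have hmu : ∀ i j, m (QPerm.u i j) = HadamardAlgebra.u hh i j := fun i j => rfl
  have hm : ∀ i j, m (QPerm.u i j) = m (QPerm.u (i - j) 0) := fun i j => by
    have : HopfImage.mk π (QPerm.u i j) = HopfImage.mk π (QPerm.u (i - j) 0) := by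
      rw [← sub_eq_zero, ← map_sub, HopfImage.mk_eq_zero_iff, hker, TwoSidedIdeal.mem_ker, map_sub,
        cyclicRep_u, cyclicRep_u, sub_eq_zero]
      exact cyclicMagic_congr (by ring)
    exact congrArg (CStarEnvelope.of _) this
  let g : C(ZMod n, ℂ) →⋆ₐ[ℂ] HadamardAlgebra hh :=
    { cyclicFactor m with
      map_star' := fun x => by
        change cyclicFactor m (star x) = star (cyclicFactor m x)
        rw [cyclicFactor_apply, cyclicFactor_apply, star_sum]
        refine Finset.sum_congr rfl fun k _ => ?_
        rw [star_smul, hmu, (HadamardAlgebra.isSelfAdjoint_u hh k 0).star_eq]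
        rfl }
  have hgu : ∀ i j, g (cyclicMagic i j) = HadamardAlgebra.u hh i j := fun i j =>
    cyclicFactor_cyclicMagic m hm i j
  refine ⟨StarAlgEquiv.ofStarAlgHom f g ?_ ?_, hfu⟩
  · refine HadamardAlgebra.starAlgHom_ext fun i j => ?_
    rw [StarAlgHom.comp_apply, hfu, hgu]
    rfl
  · refine StarAlgHom.ext fun x => ?_
    rw [eq_sum_smul_cyclicMagic x]
    simp only [map_sum, map_smul, StarAlgHom.comp_apply, hgu, hfu]
    rfl

end Cyclic

/-! ## Tensor products of Hadamard matrices -/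

theorem IsMagic.map {ι B C : Type*} [Fintype ι] [Ring B] [Ring C] {v : ι → ι → B}
    (hv : IsMagic v) (f : B →+* C) : IsMagic fun i j => f (v i j) where
  idem i j := by rw [← map_mul, hv.idem]
  row_orth i j k h := by rw [← map_mul, hv.row_orth i j k h, map_zero]
  col_orth i j k h := by rw [← map_mul, hv.col_orth i j k h, map_zero]
  row_sum i := by rw [← map_sum, hv.row_sum, map_one]
  col_sum j := by rw [← map_sum, hv.col_sum, map_one]

theorem IsMagic.tensor {ι κ A B : Type*} [Fintype ι] [Fintype κ] [Ring A] [Algebra ℂ A] [Ring B]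
    [Algebra ℂ B] {v : ι → ι → A} {w : κ → κ → B} (hv : IsMagic v) (hw : IsMagic w) :
    IsMagic fun x y : ι × κ => v x.1 y.1 ⊗ₜ[ℂ] w x.2 y.2 := by
  refine ⟨fun x y => ?_, fun x y z h => ?_, fun x y z h => ?_, fun x => ?_, fun y => ?_⟩
  · rw [Algebra.TensorProduct.tmul_mul_tmul, hv.idem, hw.idem]
  · rw [Algebra.TensorProduct.tmul_mul_tmul]
    by_cases h1 : y.1 = z.1
    · rw [hw.row_orth _ _ _ fun h2 => h (Prod.ext h1 h2), TensorProduct.tmul_zero]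
    · rw [hv.row_orth _ _ _ h1, TensorProduct.zero_tmul]
  · rw [Algebra.TensorProduct.tmul_mul_tmul]
    by_cases h1 : x.1 = z.1
    · rw [hw.col_orth _ _ _ fun h2 => h (Prod.ext h1 h2), TensorProduct.tmul_zero]
    · rw [hv.col_orth _ _ _ h1, TensorProduct.zero_tmul]
  · simp only [Fintype.sum_prod_type, ← TensorProduct.tmul_sum, hw.row_sum,
      ← TensorProduct.sum_tmul, hv.row_sum, Algebra.TensorProduct.one_def]
  · simp only [Fintype.sum_prod_type, ← TensorProduct.tmul_sum, hw.col_sum,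
      ← TensorProduct.sum_tmul, hv.col_sum, Algebra.TensorProduct.one_def]

namespace QPerm

variable {ι : Type*} [Fintype ι]

theorem comul_u (i j : ι) : comul (u i j) = ∑ k, u i k ⊗ₜ[ℂ] u k j := lift_u ..

theorem counit_u [DecidableEq ι] (i j : ι) : counit (u i j) = if i = j then 1 else 0 := lift_u ..

theorem antipode_u (i j : ι) : antipode (u i j) = MulOpposite.op (u j i) := lift_u ..

end QPerm

/-! ### Homomorphisms from quantum permutations of a product, and restriction to its factors. -/

section TensorRep

variable {ι κ : Type*} [Fintype ι] [Fintype κ] {A B : Type*} [Ring A] [Algebra ℂ A] [Ring B]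
  [Algebra ℂ B]

/-- The representation `u (i, a) (j, b) ↦ f (u i j) ⊗ g (u a b)`. -/
def tensorRep (f : QPerm ι →ₐ[ℂ] A) (g : QPerm κ →ₐ[ℂ] B) : QPerm (ι × κ) →ₐ[ℂ] A ⊗[ℂ] B :=
  QPerm.lift _ ((QPerm.isMagic_u.map f.toRingHom).tensor (QPerm.isMagic_u.map g.toRingHom))

theorem tensorRep_u (f : QPerm ι →ₐ[ℂ] A) (g : QPerm κ →ₐ[ℂ] B) (x y : ι × κ) :
    tensorRep f g (QPerm.u x y) = f (QPerm.u x.1 y.1) ⊗ₜ[ℂ] g (QPerm.u x.2 y.2) :=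
  QPerm.lift_u ..

/-- The second leg collapses to a row sum. Such partial sums put both legs in the range of
`tensorRep` and later define the embeddings of the two factors. -/
theorem tensorRep_sum_right (f : QPerm ι →ₐ[ℂ] A) (g : QPerm κ →ₐ[ℂ] B) (i j : ι) (a : κ) :
    tensorRep f g (∑ b, QPerm.u (i, a) (j, b)) = f (QPerm.u i j) ⊗ₜ[ℂ] 1 := by
  simp only [map_sum, tensorRep_u, ← TensorProduct.tmul_sum]
  rw [← map_sum, QPerm.isMagic_u.row_sum, map_one]

theorem tensorRep_sum_left (f : QPerm ι →ₐ[ℂ] A) (g : QPerm κ →ₐ[ℂ] B) (i : ι) (a b : κ) :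
    tensorRep f g (∑ j, QPerm.u (i, a) (j, b)) = 1 ⊗ₜ[ℂ] g (QPerm.u a b) := by
  simp only [map_sum, tensorRep_u, ← TensorProduct.sum_tmul]
  rw [← map_sum, QPerm.isMagic_u.row_sum, map_one]

theorem tensorRep_surjective [Nonempty ι] [Nonempty κ] {f : QPerm ι →ₐ[ℂ] A}
    {g : QPerm κ →ₐ[ℂ] B} (hf : Function.Surjective f) (hg : Function.Surjective g) :
    Function.Surjective (tensorRep f g) := by
  intro t
  change t ∈ (tensorRep f g).range
  have hl : ∀ x : QPerm ι, f x ⊗ₜ[ℂ] 1 ∈ (tensorRep f g).range := fun x =>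
    QPerm.mem_of_u_mem ((tensorRep f g).range.comap
      ((Algebra.TensorProduct.includeLeft : A →ₐ[ℂ] A ⊗[ℂ] B).comp f))
      (fun i j => ⟨_, tensorRep_sum_right f g i j (Classical.arbitrary κ)⟩) x
  have hr : ∀ x : QPerm κ, 1 ⊗ₜ[ℂ] g x ∈ (tensorRep f g).range := fun x =>
    QPerm.mem_of_u_mem ((tensorRep f g).range.comap
      ((Algebra.TensorProduct.includeRight : B →ₐ[ℂ] A ⊗[ℂ] B).comp g))
      (fun a b => ⟨_, tensorRep_sum_left f g (Classical.arbitrary ι) a b⟩) x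
  induction t using TensorProduct.induction_on with
  | zero => exact zero_mem _
  | add x y hx hy => exact add_mem hx hy
  | tmul a b =>
    obtain ⟨a, rfl⟩ := hf a
    obtain ⟨b, rfl⟩ := hg b
    have := mul_mem (hl a) (hr b)
    rwa [Algebra.TensorProduct.tmul_mul_tmul, mul_one, one_mul] at this

variable [DecidableEq ι] [DecidableEq κ]

variable (ι κ) in
/-- The projection of quantum permutations of a product onto those of the first factor. -/
def fstRep : QPerm (ι × κ) →ₐ[ℂ] QPerm ι :=
  (Algebra.TensorProduct.rid ℂ ℂ (QPerm ι)).toAlgHom.comp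
    (tensorRep (AlgHom.id ℂ (QPerm ι)) QPerm.counit)

variable (ι κ) in
/-- The projection of quantum permutations of a product onto those of the second factor. -/
def sndRep : QPerm (ι × κ) →ₐ[ℂ] QPerm κ :=
  (Algebra.TensorProduct.lid ℂ (QPerm κ)).toAlgHom.comp
    (tensorRep QPerm.counit (AlgHom.id ℂ (QPerm κ)))

theorem fstRep_u (x y : ι × κ) :
    fstRep ι κ (QPerm.u x y) = if x.2 = y.2 then QPerm.u x.1 y.1 else 0 := by
  rw [fstRep, AlgHom.comp_apply, tensorRep_u, QPerm.counit, QPerm.lift_u]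
  simp

theorem sndRep_u (x y : ι × κ) :
    sndRep ι κ (QPerm.u x y) = if x.1 = y.1 then QPerm.u x.2 y.2 else 0 := by
  rw [sndRep, AlgHom.comp_apply, tensorRep_u, QPerm.counit, QPerm.lift_u]
  simp

/-- `fstRep` is a surjective homomorphism compatible with all Hopf *-structure maps, so
`map_mem_hopfKernel` applies. -/
theorem fstRep_mem_hopfKernel [Nonempty κ] (π : QPerm (ι × κ) →ₐ[ℂ] A) (ρ : QPerm ι →ₐ[ℂ] B)
    (hker : ∀ x, π x = 0 → ρ (fstRep ι κ x) = 0) {x : QPerm (ι × κ)} (hx : x ∈ hopfKernel π) :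
    fstRep ι κ x ∈ hopfKernel ρ := by
  refine map_mem_hopfKernel π ρ (fstRep ι κ) (QPerm.surjective_of_u_mem_range fun i j => ?_)
    (fun x y => ?_) (fun x y => ?_) (fun x y => ?_) (fun x y => ?_)
    (fun x hx => hker x (apply_eq_zero_of_mem_hopfKernel π hx)) hx
  · obtain ⟨a⟩ := ‹Nonempty κ›
    exact ⟨QPerm.u (i, a) (j, a), by simp [fstRep_u]⟩
  · rw [isSelfAdjoint_iff, fstRep_u]
    split_ifs <;> simp [QPerm.star_u]
  · simp only [fstRep_u, Fintype.sum_prod_type, TensorProduct.ite_tmul, TensorProduct.tmul_ite]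
    by_cases h : x.2 = y.2
    · simp [h, QPerm.comul_u]
    · simp [h]
  · simp only [fstRep_u, apply_ite, map_zero]
    rw [QPerm.counit, QPerm.lift_u]
    simp [Prod.ext_iff, ← ite_and, and_comm]
  · by_cases h : x.2 = y.2
    · simp [fstRep_u, h, QPerm.antipode_u]
    · simp [fstRep_u, h, Ne.symm h]

theorem sndRep_mem_hopfKernel [Nonempty ι] (π : QPerm (ι × κ) →ₐ[ℂ] A) (ρ : QPerm κ →ₐ[ℂ] B)
    (hker : ∀ x, π x = 0 → ρ (sndRep ι κ x) = 0) {x : QPerm (ι × κ)} (hx : x ∈ hopfKernel π) :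
    sndRep ι κ x ∈ hopfKernel ρ := by
  refine map_mem_hopfKernel π ρ (sndRep ι κ) (QPerm.surjective_of_u_mem_range fun a b => ?_)
    (fun x y => ?_) (fun x y => ?_) (fun x y => ?_) (fun x y => ?_)
    (fun x hx => hker x (apply_eq_zero_of_mem_hopfKernel π hx)) hx
  · obtain ⟨i⟩ := ‹Nonempty ι›
    exact ⟨QPerm.u (i, a) (i, b), by simp [sndRep_u]⟩
  · rw [isSelfAdjoint_iff, sndRep_u]
    split_ifs <;> simp [QPerm.star_u]
  · simp only [sndRep_u, Fintype.sum_prod_type_right, TensorProduct.ite_tmul, TensorProduct.tmul_ite]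
    by_cases h : x.1 = y.1
    · simp [h, QPerm.comul_u]
    · simp [h]
  · simp only [sndRep_u, apply_ite, map_zero]
    rw [QPerm.counit, QPerm.lift_u]
    simp [Prod.ext_iff, ← ite_and]
  · by_cases h : x.1 = y.1
    · simp [sndRep_u, h, QPerm.antipode_u]
    · simp [sndRep_u, h, Ne.symm h]

/-- In `∑ z, u x z ⊗ u z y`, the two restrictions leave only the term `z = (y.1, x.2)`. -/
theorem tensorRep_eq_comul (f : QPerm ι →ₐ[ℂ] A) (g : QPerm κ →ₐ[ℂ] B) :
    tensorRep f g = (Algebra.TensorProduct.map (f.comp (fstRep ι κ))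
      (g.comp (sndRep ι κ))).comp QPerm.comul := by
  refine QPerm.algHom_ext fun x y => ?_
  rw [AlgHom.comp_apply, QPerm.comul, QPerm.lift_u, map_sum, tensorRep_u]
  simp only [Fintype.sum_prod_type, Algebra.TensorProduct.map_tmul, AlgHom.comp_apply, fstRep_u,
    sndRep_u, apply_ite, map_zero, TensorProduct.ite_tmul, TensorProduct.tmul_zero]
  simp

/-- The tensor product of two Hopf images is a Hopf quotient of the algebra of quantum
permutations of the product. -/
theorem isHopfStarIdeal_ker_tensorRep [Nonempty ι] [Nonempty κ] (π : QPerm ι →ₐ[ℂ] A)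
    (ρ : QPerm κ →ₐ[ℂ] B) :
    IsHopfStarIdeal (TwoSidedIdeal.ker (tensorRep (HopfImage.mk π) (HopfImage.mk ρ))) := by
  refine isHopfStarIdeal_ker _
    (tensorRep_surjective (HopfImage.mk_surjective π) (HopfImage.mk_surjective ρ))
    (fun x y => ?_)
    ((Algebra.TensorProduct.tensorTensorTensorComm ℂ ℂ ℂ ℂ (HopfImage π) (HopfImage π)
      (HopfImage ρ) (HopfImage ρ)).toAlgHom.comp
        (Algebra.TensorProduct.map (HopfImage.comul π) (HopfImage.comul ρ)))
    (fun x y => ?_)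
    ((Algebra.TensorProduct.lid ℂ ℂ).toAlgHom.comp
      (Algebra.TensorProduct.map (HopfImage.counit π) (HopfImage.counit ρ))) (fun x y => ?_)
    ((Algebra.TensorProduct.opAlgEquiv ℂ ℂ (HopfImage π) (HopfImage ρ)).toAlgHom.comp
      (Algebra.TensorProduct.map (HopfImage.antipode π) (HopfImage.antipode ρ))) fun x y => ?_
  · rw [isSelfAdjoint_iff, tensorRep_u, TensorProduct.star_tmul, HopfImage.star_mk_u,
      HopfImage.star_mk_u]
  · simp only [tensorRep_u, AlgHom.comp_apply, Algebra.TensorProduct.map_tmul, HopfImage.comul_u,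
      TensorProduct.sum_tmul, TensorProduct.tmul_sum, map_sum, Fintype.sum_prod_type]
    rw [Finset.sum_comm]
    rfl
  · simp only [tensorRep_u, AlgHom.comp_apply, Algebra.TensorProduct.map_tmul, HopfImage.counit_u]
    simp [Prod.ext_iff, ← ite_and, and_comm]
  · simp only [tensorRep_u, AlgHom.comp_apply, Algebra.TensorProduct.map_tmul,
      HopfImage.antipode_u]
    rfl

end TensorRep

/-! ### The Hopf kernel of a tensor product of Hadamard matrices. -/

section Kronecker

variable {ι κ : Type*} [Fintype ι] [Fintype κ] [DecidableEq ι] [DecidableEq κ]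
  {h' : Matrix ι ι ℂ} {h'' : Matrix κ κ ℂ}

/-- The constant vector is fixed by the diagonal projections and killed by the others. -/
theorem sum_lineProjection_magicBasis [Nonempty ι] (hh : h'.IsHadamard) (i j k : ι) :
    ∑ l, lineProjection (magicBasis h' i j) k l = if i = j then 1 else 0 := by
  have hs : ∑ l, star (magicBasis h' i j l) = if i = j then (Fintype.card ι : ℂ) else 0 := by
    rw [← hh.sum_apply_mul_star i j]
    refine Finset.sum_congr rfl fun l _ => ?_
    rw [magicBasis_apply hh, star_mul, star_star]
  simp only [lineProjection_magicBasis_apply hh, ← Finset.mul_sum, hs]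
  split_ifs with hij
  · rw [← hij, magicBasis_apply hh, hh.apply_mul_star, one_mul, inv_mul_cancel₀]
    exact Nat.cast_ne_zero.mpr Fintype.card_ne_zero
  · simp

theorem lineProjection_magicBasis_kronecker (hh' : h'.IsHadamard) (hh'' : h''.IsHadamard)
    (x y : ι × κ) : lineProjection (magicBasis (h' ⊗ₖ h'') x y) =
      lineProjection (magicBasis h' x.1 y.1) ⊗ₖ lineProjection (magicBasis h'' x.2 y.2) := by
  ext k l
  rw [lineProjection_magicBasis_apply (hh'.kronecker hh''), Matrix.kroneckerMap_apply,
    lineProjection_magicBasis_apply hh', lineProjection_magicBasis_apply hh'']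
  simp only [magicBasis_apply (hh'.kronecker hh''), magicBasis_apply hh', magicBasis_apply hh'',
    Matrix.kroneckerMap_apply, Fintype.card_prod, Nat.cast_mul, mul_inv, star_mul', star_star]
  ring

theorem QPerm.intertwines_of_u {m n : Type*} [Fintype m] [Fintype n] [DecidableEq m]
    [DecidableEq n] (f : QPerm ι →ₐ[ℂ] Matrix m m ℂ) (g : QPerm ι →ₐ[ℂ] Matrix n n ℂ)
    (E : Matrix m n ℂ) (h : ∀ i j, f (QPerm.u i j) * E = E * g (QPerm.u i j)) (x : QPerm ι) :
    f x * E = E * g x := by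
  let S : Subalgebra ℂ (QPerm ι) :=
    { carrier := {x | f x * E = E * g x}
      mul_mem' := fun {a b} ha hb => by
        simp only [Set.mem_ofPred_eq] at ha hb ⊢
        rw [map_mul, map_mul, Matrix.mul_assoc, hb, ← Matrix.mul_assoc, ha, Matrix.mul_assoc]
      add_mem' := fun {a b} ha hb => by
        simp only [Set.mem_ofPred_eq] at ha hb ⊢
        rw [map_add, map_add, Matrix.add_mul, Matrix.mul_add, ha, hb]
      algebraMap_mem' := fun c => by
        simp [Algebra.algebraMap_eq_smul_one] }
  exact QPerm.mem_of_u_mem S h x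

/-- The matrix `E` embeds `ℂ^ι` as `ℂ^ι ⊗ 1`, with `1` the constant vector. By
`sum_lineProjection_magicBasis` it intertwines the two representations, and it is injective. -/
theorem hadamardRep_fstRep_eq_zero [Nonempty κ] (hh' : h'.IsHadamard) (hh'' : h''.IsHadamard)
    (x : QPerm (ι × κ)) (hx : hadamardRep (hh'.kronecker hh'') x = 0) :
    hadamardRep hh' (fstRep ι κ x) = 0 := by
  let E : Matrix (ι × κ) ι ℂ := Matrix.of fun x l => if x.1 = l then 1 else 0
  have h := QPerm.intertwines_of_u (hadamardRep (hh'.kronecker hh''))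
    ((hadamardRep hh').comp (fstRep ι κ)) E (fun y z => by
      ext k l
      rw [AlgHom.comp_apply, fstRep_u, apply_ite (hadamardRep hh'), hadamardRep_u, hadamardRep_u,
        map_zero, lineProjection_magicBasis_kronecker hh' hh'']
      simp only [Matrix.mul_apply, E, Matrix.of_apply, Fintype.sum_prod_type, Matrix.kroneckerMap_apply, mul_ite,
        mul_one, mul_zero, Finset.sum_ite_irrel, ← Finset.mul_sum,
        sum_lineProjection_magicBasis hh'']
      split_ifs <;> simp) x
  rw [hx, Matrix.zero_mul] at h
  obtain ⟨c⟩ := ‹Nonempty κ›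
  ext k l
  have hkl := congrFun (congrFun h (k, c)) l
  simpa [Matrix.mul_apply, E] using hkl.symm

theorem hadamardRep_sndRep_eq_zero [Nonempty ι] (hh' : h'.IsHadamard) (hh'' : h''.IsHadamard)
    (x : QPerm (ι × κ)) (hx : hadamardRep (hh'.kronecker hh'') x = 0) :
    hadamardRep hh'' (sndRep ι κ x) = 0 := by
  let E : Matrix (ι × κ) κ ℂ := Matrix.of fun x l => if x.2 = l then 1 else 0
  have h := QPerm.intertwines_of_u (hadamardRep (hh'.kronecker hh''))
    ((hadamardRep hh'').comp (sndRep ι κ)) E (fun y z => by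
      ext k l
      rw [AlgHom.comp_apply, sndRep_u, apply_ite (hadamardRep hh''), hadamardRep_u, hadamardRep_u,
        map_zero, lineProjection_magicBasis_kronecker hh' hh'']
      simp only [Matrix.mul_apply, E, Matrix.of_apply, Fintype.sum_prod_type_right, Matrix.kroneckerMap_apply,
        mul_ite, mul_one, mul_zero, Finset.sum_ite_irrel, ← Finset.sum_mul,
        sum_lineProjection_magicBasis hh']
      split_ifs <;> simp) x
  rw [hx, Matrix.zero_mul] at h
  obtain ⟨c⟩ := ‹Nonempty ι›
  ext k l
  have hkl := congrFun (congrFun h (c, k)) l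
  simpa [Matrix.mul_apply, E] using hkl.symm

/-- The representation of the Kronecker product factors through `tensorRep`, followed by the tensor
product of the representations of the two Hopf images. -/
theorem hadamardRep_eq_zero_of_tensorRep (hh' : h'.IsHadamard) (hh'' : h''.IsHadamard)
    (x : QPerm (ι × κ)) (hx : tensorRep (HopfImage.mk (hadamardRep hh'))
      (HopfImage.mk (hadamardRep hh'')) x = 0) : hadamardRep (hh'.kronecker hh'') x = 0 := by
  let f' := HopfImage.lift (hadamardRep hh') (hadamardRep hh')
    fun _ => apply_eq_zero_of_mem_hopfKernel _
  let f'' := HopfImage.lift (hadamardRep hh'') (hadamardRep hh'')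
    fun _ => apply_eq_zero_of_mem_hopfKernel _
  let k : Matrix ι ι ℂ ⊗[ℂ] Matrix κ κ ℂ →ₐ[ℂ] Matrix (ι × κ) (ι × κ) ℂ :=
    (Matrix.kroneckerAlgEquiv ι κ ℂ).toAlgHom
  have hc : (k.comp (Algebra.TensorProduct.map f' f'')).comp
      (tensorRep (HopfImage.mk (hadamardRep hh')) (HopfImage.mk (hadamardRep hh''))) =
      hadamardRep (hh'.kronecker hh'') := QPerm.algHom_ext fun y z => by
    rw [AlgHom.comp_apply, AlgHom.comp_apply, tensorRep_u, Algebra.TensorProduct.map_tmul,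
      hadamardRep_u, lineProjection_magicBasis_kronecker hh' hh'', HopfImage.lift_mk,
      HopfImage.lift_mk, hadamardRep_u, hadamardRep_u]
    ext
    simp [k]
  rw [← hc, AlgHom.comp_apply, hx, map_zero]

/-- One inclusion is maximality. For the other, `tensorRep_eq_comul` writes the map as `(f ⊗ g) ∘ Δ`
with `f` and `g` killing the Hopf kernel `J`, while `Δ(J) ⊆ J ⊗ 𝒜 + 𝒜 ⊗ J`. -/
theorem hopfKernel_kronecker [Nonempty ι] [Nonempty κ] (hh' : h'.IsHadamard)
    (hh'' : h''.IsHadamard) : hopfKernel (hadamardRep (hh'.kronecker hh'')) =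
      TwoSidedIdeal.ker (tensorRep (HopfImage.mk (hadamardRep hh'))
        (HopfImage.mk (hadamardRep hh''))) := by
  refine le_antisymm (fun x hx => ?_) (le_hopfKernel _ (isHopfStarIdeal_ker_tensorRep _ _)
    fun x hx => hadamardRep_eq_zero_of_tensorRep hh' hh'' x ((TwoSidedIdeal.mem_ker _).mp hx))
  rw [TwoSidedIdeal.mem_ker, tensorRep_eq_comul, AlgHom.comp_apply]
  refine (isHopfStarIdeal_hopfKernel _).tensorMap_comul_eq_zero
    ((HopfImage.mk (hadamardRep hh')).comp (fstRep ι κ))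
    ((HopfImage.mk (hadamardRep hh'')).comp (sndRep ι κ)) (fun y hy => ?_) (fun y hy => ?_) hx
  · rw [AlgHom.comp_apply, HopfImage.mk_eq_zero_iff]
    exact fstRep_mem_hopfKernel _ _ (hadamardRep_fstRep_eq_zero hh' hh'') hy
  · rw [AlgHom.comp_apply, HopfImage.mk_eq_zero_iff]
    exact sndRep_mem_hopfKernel _ _ (hadamardRep_sndRep_eq_zero hh' hh'') hy

end Kronecker

/-! ### Universal property of the maximal tensor product. -/

namespace MaxTensor

variable {A B C : Type*} [CStarAlgebra A] [CStarAlgebra B] [CStarAlgebra C]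

theorem tmul_mul_tmul (a a' : A) (b b' : B) :
    tmul a b * tmul a' b' = tmul (a * a') (b * b') := by
  rw [tmul, tmul, ← map_mul, Algebra.TensorProduct.tmul_mul_tmul, tmul]

variable (A B) in
/-- The *-homomorphism `a ↦ a ⊗ 1`. -/
def inl : A →⋆ₐ[ℂ] MaxTensor A B :=
  (CStarEnvelope.of (A ⊗[ℂ] B)).comp
    { (Algebra.TensorProduct.includeLeft : A →ₐ[ℂ] A ⊗[ℂ] B) with map_star' := fun a => by simp }

variable (A B) in
/-- The *-homomorphism `b ↦ 1 ⊗ b`. -/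
def inr : B →⋆ₐ[ℂ] MaxTensor A B :=
  (CStarEnvelope.of (A ⊗[ℂ] B)).comp
    { (Algebra.TensorProduct.includeRight : B →ₐ[ℂ] A ⊗[ℂ] B) with map_star' := fun a => by simp }

theorem inl_apply (a : A) : inl A B a = tmul a 1 := rfl

theorem inr_apply (b : B) : inr A B b = tmul 1 b := rfl

theorem starAlgHom_ext {f g : MaxTensor A B →⋆ₐ[ℂ] C} (hl : f.comp (inl A B) = g.comp (inl A B))
    (hr : f.comp (inr A B) = g.comp (inr A B)) : f = g := by
  refine CStarEnvelope.starAlgHom_ext fun t => ?_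
  induction t using TensorProduct.induction_on with
  | zero => simp
  | add x y hx hy => rw [map_add, map_add, map_add, hx, hy]
  | tmul a b =>
    have h : CStarEnvelope.of (A ⊗[ℂ] B) (a ⊗ₜ[ℂ] b) = inl A B a * inr A B b := by
      rw [inl_apply, inr_apply, tmul_mul_tmul, mul_one, one_mul, tmul]
    have h1 : f (inl A B a) = g (inl A B a) := DFunLike.congr_fun hl a
    have h2 : f (inr A B b) = g (inr A B b) := DFunLike.congr_fun hr b
    rw [h, map_mul, map_mul, h1, h2]

/-- The algebraic tensor product of two *-homomorphisms with commuting ranges. -/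
def liftAlg (f : A →⋆ₐ[ℂ] C) (g : B →⋆ₐ[ℂ] C) (hfg : ∀ a b, Commute (f a) (g b)) :
    A ⊗[ℂ] B →⋆ₐ[ℂ] C where
  __ := Algebra.TensorProduct.lift f.toAlgHom g.toAlgHom hfg
  map_star' t := by
    change Algebra.TensorProduct.lift f.toAlgHom g.toAlgHom hfg (star t) =
      star (Algebra.TensorProduct.lift f.toAlgHom g.toAlgHom hfg t)
    induction t using TensorProduct.induction_on with
    | zero => simp
    | add x y hx hy => rw [star_add, map_add, map_add, star_add, hx, hy]
    | tmul a b =>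
      rw [TensorProduct.star_tmul, Algebra.TensorProduct.lift_tmul,
        Algebra.TensorProduct.lift_tmul, star_mul]
      change f (star a) * g (star b) = star (g b) * star (f a)
      rw [(hfg _ _).eq, map_star, map_star]

/-- The universal property of the maximal tensor product. -/
def lift (f : A →⋆ₐ[ℂ] C) (g : B →⋆ₐ[ℂ] C) (hfg : ∀ a b, Commute (f a) (g b)) :
    MaxTensor A B →⋆ₐ[ℂ] C :=
  CStarEnvelope.lift (IsCStarSeminorm.bddAbove_tensorProduct A B) (liftAlg f g hfg)

theorem lift_tmul (f : A →⋆ₐ[ℂ] C) (g : B →⋆ₐ[ℂ] C) (hfg : ∀ a b, Commute (f a) (g b))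
    (a : A) (b : B) : lift f g hfg (tmul a b) = f a * g b :=
  CStarEnvelope.lift_of ..

end MaxTensor

/-! ### From Hopf images to C*-envelopes for tensor products. -/

section KroneckerEnvelope

variable {ι κ : Type*} [Fintype ι] [Fintype κ] [DecidableEq ι] [DecidableEq κ]
  {h' : Matrix ι ι ℂ} {h'' : Matrix κ κ ℂ}

/-- The quantum permutation algebra of a tensor product of Hadamard matrices. -/
theorem exists_hadamardAlgebra_kronecker_equiv [Nonempty ι] [Nonempty κ] (hh' : h'.IsHadamard)
    (hh'' : h''.IsHadamard) :
    ∃ φ : HadamardAlgebra (hh'.kronecker hh'') ≃⋆ₐ[ℂ]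
        MaxTensor (HadamardAlgebra hh') (HadamardAlgebra hh''),
      ∀ i a j b, φ (HadamardAlgebra.u (hh'.kronecker hh'') (i, a) (j, b)) =
        MaxTensor.tmul (HadamardAlgebra.u hh' i j) (HadamardAlgebra.u hh'' a b) := by
  set π' := hadamardRep hh'
  set π'' := hadamardRep hh''
  set π := hadamardRep (hh'.kronecker hh'')
  let A' := HadamardAlgebra hh'
  let A'' := HadamardAlgebra hh''
  let A := HadamardAlgebra (hh'.kronecker hh'')
  let ψ := tensorRep (HopfImage.mk π') (HopfImage.mk π'')
  have hψ : Function.Surjective ψ :=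
    tensorRep_surjective (HopfImage.mk_surjective π') (HopfImage.mk_surjective π'')
  have hker : ∀ x, x ∈ hopfKernel π ↔ ψ x = 0 := fun x => by
    rw [hopfKernel_kronecker hh' hh'', TwoSidedIdeal.mem_ker]
  let e₀ : HopfImage π →ₐ[ℂ] HopfImage π' ⊗[ℂ] HopfImage π'' :=
    HopfImage.lift π ψ fun x hx => (hker x).mp hx
  have he₀ : Function.Bijective e₀ := by
    refine ⟨(injective_iff_map_eq_zero e₀).mpr fun x hx => ?_, fun t => ?_⟩
    · obtain ⟨x, rfl⟩ := HopfImage.mk_surjective π x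
      exact (HopfImage.mk_eq_zero_iff π).mpr ((hker x).mpr hx)
    · obtain ⟨x, rfl⟩ := hψ t
      exact ⟨HopfImage.mk π x, rfl⟩
  let e := AlgEquiv.ofBijective e₀ he₀
  have hsymm : ∀ x, e.symm (ψ x) = HopfImage.mk π x := fun x => by
    rw [AlgEquiv.symm_apply_eq]
    rfl
  let F : A →⋆ₐ[ℂ] MaxTensor A' A'' :=
    CStarEnvelope.lift (HopfImage.bddAbove_isCStarSeminorm π) (HopfImage.toStarAlgHom π
      (((CStarEnvelope.of (A' ⊗[ℂ] A'')).toAlgHom.comp (Algebra.TensorProduct.map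
        (CStarEnvelope.of (HopfImage π')).toAlgHom (CStarEnvelope.of (HopfImage π'')).toAlgHom)).comp
          e₀) fun x y => by
        have : e₀ (HopfImage.mk π (QPerm.u x y)) = _ := tensorRep_u _ _ x y
        rw [isSelfAdjoint_iff, AlgHom.comp_apply, AlgHom.comp_apply, this,
          Algebra.TensorProduct.map_tmul]
        change star (CStarEnvelope.of _ (HadamardAlgebra.u hh' x.1 y.1 ⊗ₜ[ℂ]
          HadamardAlgebra.u hh'' x.2 y.2)) = CStarEnvelope.of _ (HadamardAlgebra.u hh' x.1 y.1 ⊗ₜ[ℂ]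
          HadamardAlgebra.u hh'' x.2 y.2)
        rw [← map_star, TensorProduct.star_tmul, (HadamardAlgebra.isSelfAdjoint_u hh' _ _).star_eq,
          (HadamardAlgebra.isSelfAdjoint_u hh'' _ _).star_eq])
  have hF : ∀ x y, F (HadamardAlgebra.u (hh'.kronecker hh'') x y) =
      MaxTensor.tmul (HadamardAlgebra.u hh' x.1 y.1) (HadamardAlgebra.u hh'' x.2 y.2) :=
    fun x y => by
      refine (CStarEnvelope.lift_of ..).trans ?_
      have : e₀ (HopfImage.mk π (QPerm.u x y)) = _ := tensorRep_u _ _ x y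
      rw [HopfImage.toStarAlgHom_apply, AlgHom.comp_apply, AlgHom.comp_apply, this,
        Algebra.TensorProduct.map_tmul]
      rfl
  -- The inverse is built from the legs `x ↦ x ⊗ 1` and `y ↦ 1 ⊗ y`, transported by `e.symm`; on
  -- generators they are partial sums, whatever base index is chosen.
  let l₀ : HopfImage π' →ₐ[ℂ] A := ((CStarEnvelope.of (HopfImage π)).toAlgHom.comp
    e.symm.toAlgHom).comp Algebra.TensorProduct.includeLeft
  let r₀ : HopfImage π'' →ₐ[ℂ] A := ((CStarEnvelope.of (HopfImage π)).toAlgHom.comp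
    e.symm.toAlgHom).comp Algebra.TensorProduct.includeRight
  have hl₀ : ∀ i j a, l₀ (HopfImage.mk π' (QPerm.u i j)) =
      ∑ b, HadamardAlgebra.u (hh'.kronecker hh'') (i, a) (j, b) := fun i j a => by
    have h := hsymm (∑ b, QPerm.u (i, a) (j, b))
    rw [tensorRep_sum_right] at h
    refine (congrArg (CStarEnvelope.of (HopfImage π)) h).trans ?_
    rw [map_sum, map_sum]
    rfl
  have hr₀ : ∀ i a b, r₀ (HopfImage.mk π'' (QPerm.u a b)) =
      ∑ j, HadamardAlgebra.u (hh'.kronecker hh'') (i, a) (j, b) := fun i a b => by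
    have h := hsymm (∑ j, QPerm.u (i, a) (j, b))
    rw [tensorRep_sum_left] at h
    refine (congrArg (CStarEnvelope.of (HopfImage π)) h).trans ?_
    rw [map_sum, map_sum]
    rfl
  let i₀ := Classical.arbitrary ι
  let a₀ := Classical.arbitrary κ
  let l : A' →⋆ₐ[ℂ] A := CStarEnvelope.lift (HopfImage.bddAbove_isCStarSeminorm π')
    (HopfImage.toStarAlgHom π' l₀ fun i j => by
      rw [hl₀ i j a₀, isSelfAdjoint_iff, star_sum]
      exact Finset.sum_congr rfl fun b _ => (HadamardAlgebra.isSelfAdjoint_u _ _ _).star_eq)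
  let r : A'' →⋆ₐ[ℂ] A := CStarEnvelope.lift (HopfImage.bddAbove_isCStarSeminorm π'')
    (HopfImage.toStarAlgHom π'' r₀ fun a b => by
      rw [hr₀ i₀ a b, isSelfAdjoint_iff, star_sum]
      exact Finset.sum_congr rfl fun b _ => (HadamardAlgebra.isSelfAdjoint_u _ _ _).star_eq)
  have hl : ∀ x, l (CStarEnvelope.of _ x) = l₀ x := fun x => CStarEnvelope.lift_of ..
  have hr : ∀ x, r (CStarEnvelope.of _ x) = r₀ x := fun x => CStarEnvelope.lift_of ..
  have hlr₀ : ∀ x y, l₀ x * r₀ y = CStarEnvelope.of (HopfImage π) (e.symm (x ⊗ₜ y)) := fun x y => by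
    change CStarEnvelope.of (HopfImage π) (e.symm (x ⊗ₜ 1)) *
      CStarEnvelope.of (HopfImage π) (e.symm (1 ⊗ₜ y)) = _
    rw [← map_mul, ← map_mul, Algebra.TensorProduct.tmul_mul_tmul, mul_one, one_mul]
  have hrl₀ : ∀ x y, r₀ y * l₀ x = CStarEnvelope.of (HopfImage π) (e.symm (x ⊗ₜ y)) := fun x y => by
    change CStarEnvelope.of (HopfImage π) (e.symm (1 ⊗ₜ y)) *
      CStarEnvelope.of (HopfImage π) (e.symm (x ⊗ₜ 1)) = _
    rw [← map_mul, ← map_mul, Algebra.TensorProduct.tmul_mul_tmul, mul_one, one_mul]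
  -- On the dense images both products equal `e.symm (x ⊗ y)`; commutation extends by density in one
  -- variable at a time.
  have hcomm : ∀ x y, Commute (l x) (r y) := fun x y =>
    CStarEnvelope.commute_of_forall l (fun x => (CStarEnvelope.commute_of_forall r (fun y => by
      rw [hl, hr, commute_iff_eq, hlr₀, hrl₀]) y).symm) x
  let G := MaxTensor.lift l r hcomm
  refine ⟨StarAlgEquiv.ofStarAlgHom F G ?_ ?_, fun i a j b => hF (i, a) (j, b)⟩
  · refine HadamardAlgebra.starAlgHom_ext fun x y => ?_
    rw [StarAlgHom.comp_apply, hF]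
    refine (MaxTensor.lift_tmul ..).trans ?_
    rw [HadamardAlgebra.u, HadamardAlgebra.u, hl, hr, hlr₀]
    have h := hsymm (QPerm.u x y)
    rw [tensorRep_u] at h
    exact congrArg (CStarEnvelope.of (HopfImage π)) h
  · refine MaxTensor.starAlgHom_ext ?_ ?_
    · refine HadamardAlgebra.starAlgHom_ext fun i j => ?_
      change F (G (MaxTensor.tmul _ 1)) = MaxTensor.tmul _ 1
      have hG : G (MaxTensor.tmul (HadamardAlgebra.u hh' i j) 1) =
          ∑ b, HadamardAlgebra.u (hh'.kronecker hh'') (i, a₀) (j, b) := by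
        refine (MaxTensor.lift_tmul ..).trans ?_
        rw [map_one, mul_one, HadamardAlgebra.u, hl, hl₀]
      rw [hG, map_sum]
      simp only [hF]
      have hs : ∑ b, HadamardAlgebra.u hh'' a₀ b = 1 := by
        simp only [HadamardAlgebra.u, ← map_sum, QPerm.isMagic_u.row_sum, map_one]
      simp only [MaxTensor.tmul, ← map_sum, ← TensorProduct.tmul_sum, hs]
      rfl
    · refine HadamardAlgebra.starAlgHom_ext fun a b => ?_
      change F (G (MaxTensor.tmul 1 _)) = MaxTensor.tmul 1 _
      have hG : G (MaxTensor.tmul 1 (HadamardAlgebra.u hh'' a b)) =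
          ∑ j, HadamardAlgebra.u (hh'.kronecker hh'') (i₀, a) (j, b) := by
        refine (MaxTensor.lift_tmul ..).trans ?_
        rw [map_one, one_mul, HadamardAlgebra.u, hr, hr₀]
      rw [hG, map_sum]
      simp only [hF]
      have hs : ∑ j, HadamardAlgebra.u hh' i₀ j = 1 := by
        simp only [HadamardAlgebra.u, ← map_sum, QPerm.isMagic_u.row_sum, map_one]
      simp only [MaxTensor.tmul, ← map_sum, ← TensorProduct.sum_tmul, hs]
      rfl

end KroneckerEnvelope

/-! ## Commutativity -/

section LineProjection

variable {ι : Type*} [Fintype ι]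

theorem lineProjection_mul_lineProjection (v w : ι → ℂ) :
    lineProjection v * lineProjection w =
      ((star v ⬝ᵥ v)⁻¹ * (star w ⬝ᵥ w)⁻¹ * (star v ⬝ᵥ w)) • Matrix.vecMulVec v (star w) := by
  rw [lineProjection, lineProjection, smul_mul_smul_comm, Matrix.vecMulVec_mul_vecMulVec]
  simp [Matrix.vecMulVec_smul, smul_smul]

theorem lineProjection_smul {c : ℂ} (hc : c ≠ 0) (v : ι → ℂ) :
    lineProjection (c • v) = lineProjection v := by
  have hc' : star c ≠ 0 := star_ne_zero.mpr hc
  rw [lineProjection, lineProjection, star_smul, smul_dotProduct, dotProduct_smul,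
    Matrix.smul_vecMulVec, Matrix.vecMulVec_smul, smul_smul, smul_smul]
  congr 1
  simp only [smul_eq_mul, mul_inv]
  field_simp

/-- Non-orthogonal lines with commuting projections coincide. -/
theorem exists_eq_smul_of_commute {v w : ι → ℂ}
    (hc : Commute (lineProjection v) (lineProjection w))
    (h0 : lineProjection v * lineProjection w ≠ 0) : ∃ c : ℂ, v = c • w := by
  have he := hc.eq
  rw [lineProjection_mul_lineProjection] at h0
  rw [lineProjection_mul_lineProjection, lineProjection_mul_lineProjection] at he
  set a := (star v ⬝ᵥ v)⁻¹ * (star w ⬝ᵥ w)⁻¹ * (star v ⬝ᵥ w)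
  set b := (star w ⬝ᵥ w)⁻¹ * (star v ⬝ᵥ v)⁻¹ * (star w ⬝ᵥ v)
  have ha : a ≠ 0 := fun h => h0 (by rw [h, zero_smul])
  have hw : ∃ l, w l ≠ 0 := by
    by_contra! hw
    have : w = 0 := funext hw
    exact h0 (by simp [this])
  obtain ⟨l, hl⟩ := hw
  have hl' : star (w l) ≠ 0 := star_ne_zero.mpr hl
  -- Commutation says `a • v w* = b • w v*`; the scalar comes from column `l`, where `w l ≠ 0`.
  refine ⟨b * star (v l) / (a * star (w l)), funext fun k => ?_⟩
  have hk := congrFun (congrFun he k) l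
  simp only [Matrix.smul_apply, Matrix.vecMulVec_apply, Pi.star_apply, smul_eq_mul] at hk
  rw [Pi.smul_apply, smul_eq_mul, div_mul_eq_mul_div, eq_div_iff (mul_ne_zero ha hl')]
  linear_combination hk

end LineProjection

section Commutative

variable {ι : Type*} [Fintype ι] [DecidableEq ι] {h : Matrix ι ι ℂ}

open scoped Matrix.Norms.L2Operator in
-- The representation factors through the Hopf image and extends to its envelope, matrices being a
-- C*-algebra for the operator norm.
theorem commute_lineProjection_of_mul_comm (hh : h.IsHadamard)
    (hc : ∀ x y : HadamardAlgebra hh, x * y = y * x) (i j k l : ι) :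
    Commute (lineProjection (magicBasis h i j)) (lineProjection (magicBasis h k l)) := by
  let f : HadamardAlgebra hh →⋆ₐ[ℂ] Matrix ι ι ℂ :=
    CStarEnvelope.lift (HopfImage.bddAbove_isCStarSeminorm _) (HopfImage.toStarAlgHom _
      (HopfImage.lift (hadamardRep hh) (hadamardRep hh)
        fun _ => apply_eq_zero_of_mem_hopfKernel _) (isSelfAdjoint_hadamardRep_u hh))
  have hf : ∀ i j, f (HadamardAlgebra.u hh i j) = lineProjection (magicBasis h i j) :=
    fun i j => (CStarEnvelope.lift_of ..).trans (hadamardRep_u hh i j)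
  have := congrArg f (hc (HadamardAlgebra.u hh i j) (HadamardAlgebra.u hh k l))
  rwa [map_mul, map_mul, hf, hf] at this

/-- Commuting with a fixed matrix `E` is the case `f = g` of `intertwines_of_u`; using it in each
variable makes the range of the representation commutative. -/
theorem mul_comm_of_commute_lineProjection (hh : h.IsHadamard)
    (hc : ∀ i j k l, Commute (lineProjection (magicBasis h i j))
      (lineProjection (magicBasis h k l))) (x y : HadamardAlgebra hh) : x * y = y * x := by
  refine CStarEnvelope.mul_comm_of_forall (HopfImage.mul_comm_of_commute _ fun x y => ?_) x y
  have h1 : ∀ i j y, hadamardRep hh y * hadamardRep hh (QPerm.u i j) =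
      hadamardRep hh (QPerm.u i j) * hadamardRep hh y := fun i j y => by
    refine QPerm.intertwines_of_u _ _ _ (fun k l => ?_) y
    rw [hadamardRep_u, hadamardRep_u]
    exact hc k l i j
  exact QPerm.intertwines_of_u _ _ _ (fun k l => (h1 k l y).symm) x

theorem fourierTensor_div {k : ℕ} (d : Fin k → ℕ+) (x y z : ∀ s, ZMod (d s)) :
    fourierTensor d y z / fourierTensor d x z = fourierTensor d (y - x) z := by
  simp only [fourierTensor, ← Finset.prod_div_distrib, fourierMatrix_apply, Pi.sub_apply, sub_mul,
    AddChar.map_sub_eq_div]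

/-- In a quotient of rows the column scalars cancel, so up to a scalar the vector at `(i, j)` is `V
(σ j - σ i)`. Two such lines are equal or orthogonal. -/
theorem commute_lineProjection_of_hadamardEquivalent (hh : h.IsHadamard) {k : ℕ}
    {d : Fin k → ℕ+} (he : HadamardEquivalent h (fourierTensor d)) (i j i' j' : ι) :
    Commute (lineProjection (magicBasis h i j)) (lineProjection (magicBasis h i' j')) := by
  obtain ⟨σ, τ, a, b, hab⟩ := he
  let V : (∀ s, ZMod (d s)) → ι → ℂ := fun x k => fourierTensor d x (τ k)
  have hV : ∀ i j, lineProjection (magicBasis h i j) = lineProjection (V (σ j - σ i)) := by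
    intro i j
    have : magicBasis h i j = ((a j : ℂ) / a i) • V (σ j - σ i) := funext fun k => by
      simp only [magicBasis, Pi.div_apply, hab, Pi.smul_apply, smul_eq_mul, V, ← fourierTensor_div]
      have := (b k).coe_ne_zero
      rw [mul_div_mul_comm, mul_div_mul_comm, div_self this, mul_one]
    rw [this, lineProjection_smul (div_ne_zero (a j).coe_ne_zero (a i).coe_ne_zero)]
  -- Orthogonality is pulled back from the rows of `h`: the row scalars factor out and the column
  -- scalars have modulus one.
  have hort : ∀ x y, x ≠ y → star (V x) ⬝ᵥ V y = 0 := fun x y hxy => by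
    have h0 := hh.sum_apply_mul_star (σ.symm y) (σ.symm x)
    rw [if_neg fun e => hxy (σ.symm.injective e).symm] at h0
    have hs : ∀ k, h (σ.symm y) k * star (h (σ.symm x) k) =
        ((a (σ.symm y) : ℂ) * star (a (σ.symm x) : ℂ)) * (star (V x k) * V y k) := fun k => by
      have hb : (b k : ℂ) * star (b k : ℂ) = 1 := by
        change (b k : ℂ) * starRingEnd ℂ (b k : ℂ) = 1
        rw [← Circle.coe_inv_eq_conj, ← Circle.coe_mul, mul_inv_cancel, Circle.coe_one]
      simp only [hab, Equiv.apply_symm_apply, star_mul', V]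
      linear_combination (a (σ.symm y) : ℂ) * star (a (σ.symm x) : ℂ) *
        (star (fourierTensor d x (τ k)) * fourierTensor d y (τ k)) * hb
    simp only [hs, ← Finset.mul_sum] at h0
    exact (mul_eq_zero.mp h0).resolve_left
      (mul_ne_zero (Circle.coe_ne_zero _) (star_ne_zero.mpr (Circle.coe_ne_zero _)))
  rw [hV, hV]
  by_cases hxy : σ j - σ i = σ j' - σ i'
  · rw [hxy]
  · rw [commute_iff_eq, lineProjection_mul_lineProjection, lineProjection_mul_lineProjection,
      hort _ _ hxy, hort _ _ (Ne.symm hxy)]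
    simp

end Commutative

/-! ## Character tables -/

section Characters

/-- A finite commutative group is a product of cyclic groups. -/
theorem exists_equiv_pi_zmod (G : Type*) [CommGroup G] [Finite G] :
    ∃ (k : ℕ) (d : Fin k → ℕ+) (D : G ≃ ∀ s, ZMod (d s)), ∀ g g', D (g * g') = D g + D g' := by
  obtain ⟨T, _, n, hn, ⟨φ⟩⟩ := CommGroup.equiv_prod_multiplicative_zmod_of_finite G
  let e := Fintype.equivFin T
  refine ⟨Fintype.card T, fun s => ⟨n (e.symm s), (zero_lt_one.trans (hn _))⟩,
    (φ.toEquiv.trans (Equiv.piCongrLeft' _ e)).trans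
      (Equiv.piCongrRight fun s => Multiplicative.toAdd), fun g g' => ?_⟩
  ext s
  change (φ (g * g') (e.symm s)).toAdd = (φ g (e.symm s)).toAdd + (φ g' (e.symm s)).toAdd
  rw [map_mul]
  rfl

/-- The columns of a tensor product of Fourier matrices, as characters. -/
def fourierChar {k : ℕ} (d : Fin k → ℕ+) (y : ∀ s, ZMod (d s)) : AddChar (∀ s, ZMod (d s)) ℂ where
  toFun x := fourierTensor d x y
  map_zero_eq_one' := by simp [fourierTensor, fourierMatrix_apply]
  map_add_eq_mul' x x' := by
    simp only [fourierTensor, ← Finset.prod_mul_distrib, fourierMatrix_apply, Pi.add_apply,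
      add_mul, AddChar.map_add_eq_mul]

/-- Evaluation at the unit vector of index `s` recovers `y s`, which gives injectivity; a finite
abelian group has as many characters as elements. -/
theorem fourierChar_bijective {k : ℕ} (d : Fin k → ℕ+) : Function.Bijective (fourierChar d) := by
  have hinj : Function.Injective (fourierChar d) := fun y y' hy => by
    ext s
    have h1 : fourierTensor d (Pi.single s 1) y = fourierTensor d (Pi.single s 1) y' :=
      DFunLike.congr_fun hy _
    have hv : ∀ z : ∀ s, ZMod (d s),
        fourierTensor d (Pi.single s 1) z = ZMod.stdAddChar (z s) := fun z => by
      rw [fourierTensor, Finset.prod_eq_single s]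
      · rw [fourierMatrix_apply, Pi.single_eq_same, one_mul]
      · intro t _ ht
        rw [fourierMatrix_apply, Pi.single_eq_of_ne ht, zero_mul, AddChar.map_zero_eq_one]
      · simp
    rw [hv, hv] at h1
    exact ZMod.injective_stdAddChar h1
  exact (Fintype.bijective_iff_injective_and_card _).mpr ⟨hinj, AddChar.card_eq.symm⟩

variable {ι : Type*} [Fintype ι] [DecidableEq ι] [Nonempty ι] {h : Matrix ι ι ℂ}

/-- A Hadamard matrix whose associated projections commute is, up to equivalence, the character
table of a finite abelian group. -/
theorem hadamardEquivalent_of_commute_lineProjection (hh : h.IsHadamard)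
    (hc : ∀ i j k l, Commute (lineProjection (magicBasis h i j))
      (lineProjection (magicBasis h k l))) :
    ∃ (k : ℕ) (d : Fin k → ℕ+), HadamardEquivalent h (fourierTensor d) := by
  obtain ⟨o⟩ := ‹Nonempty ι›
  have hcard : (Fintype.card ι : ℂ) ≠ 0 := by
    have : Nonempty ι := ⟨o⟩
    exact Nat.cast_ne_zero.mpr Fintype.card_ne_zero
  let H : ι → ι → Circle := fun i k => ⟨h i k, by
    rw [Submonoid.unitSphere, ← SetLike.mem_coe]
    simpa using CStarRing.norm_of_mem_unitary (hh.apply_mem i k)⟩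
  have hH : ∀ i k, (H i k : ℂ) = h i k := fun i k => rfl
  -- Normalization making row `o` and column `o` constantly `1`.
  let f : ι → ι → Circle := fun i k => H i k / H o k / (H i o / H o o)
  have hf : ∀ i k, h i k = ((H i o / H o o : Circle) : ℂ) * (H o k : ℂ) * (f i k : ℂ) :=
    fun i k => by
      rw [← hH, ← Circle.coe_mul, ← Circle.coe_mul]
      congr 1
      simp only [f]
      rw [mul_assoc, mul_div_assoc', mul_div_cancel, mul_div_cancel]
  -- Equal normalized rows would make two rows of `h` proportional, against orthogonality; columns
  -- are treated likewise through the transpose.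
  have hrow : Function.Injective f := fun i j hij => by
    by_contra hne
    have h0 := hh.sum_apply_mul_star i j
    rw [if_neg hne] at h0
    have hs : ∀ k, h i k * star (h j k) =
        ((H i o / H o o : Circle) : ℂ) * ((H j o / H o o : Circle) : ℂ)⁻¹ := fun k => by
      rw [← hh.inv_apply, hf i k, hf j k, hij]
      have h1 := (H o k).coe_ne_zero
      have h2 := (f j k).coe_ne_zero
      have h3 := (H j o / H o o).coe_ne_zero
      field_simp
    simp only [hs, Finset.sum_const, Finset.card_univ, nsmul_eq_mul] at h0
    exact mul_ne_zero hcard (mul_ne_zero (Circle.coe_ne_zero _)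
      (inv_ne_zero (Circle.coe_ne_zero _))) h0
  have hcol : ∀ k l, (∀ i, f i k = f i l) → k = l := fun k l hkl => by
    by_contra hne
    have h0 := hh.transpose.sum_apply_mul_star k l
    rw [if_neg hne] at h0
    have hs : ∀ i, h.transpose k i * star (h.transpose l i) =
        (H o k : ℂ) * (H o l : ℂ)⁻¹ := fun i => by
      rw [← hh.transpose.inv_apply, Matrix.transpose_apply, Matrix.transpose_apply, hf i k, hf i l,
        hkl]
      have h1 := (H o l).coe_ne_zero
      have h2 := (f i l).coe_ne_zero
      have h3 := (H i o / H o o).coe_ne_zero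
      field_simp
    simp only [hs, Finset.sum_const, Finset.card_univ, nsmul_eq_mul] at h0
    exact mul_ne_zero hcard (mul_ne_zero (Circle.coe_ne_zero _)
      (inv_ne_zero (Circle.coe_ne_zero _))) h0
  -- As `∑ m, P o m = 1` and `P i j ≠ 0`, some `P o m` is not orthogonal to `P i j`, so the lines
  -- coincide. Normalization at column `o` removes the proportionality scalar.
  have hdiv : ∀ i j, ∃ m, f m = f j / f i := fun i j => by
    have hm : ∃ m, lineProjection (magicBasis h o m) * lineProjection (magicBasis h i j) ≠ 0 := by
      by_contra! hm
      have h1 : lineProjection (magicBasis h i j) = 0 := by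
        rw [← one_mul (lineProjection (magicBasis h i j)),
          ← (isMagic_lineProjection hh).row_sum o, Finset.sum_mul]
        exact Finset.sum_eq_zero fun m _ => hm m
      have h3 := lineProjection_magicBasis_apply hh i j o o
      rw [h1, Matrix.zero_apply, magicBasis, Pi.div_apply] at h3
      have h4 := div_ne_zero (hh.apply_ne_zero j o) (hh.apply_ne_zero i o)
      exact mul_ne_zero (inv_ne_zero hcard) (mul_ne_zero h4 (star_ne_zero.mpr h4)) h3.symm
    obtain ⟨m, hm⟩ := hm
    obtain ⟨c, hcm⟩ := exists_eq_smul_of_commute (hc o m i j) hm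
    have hk : ∀ k, h m k / h o k = c * (h j k / h i k) := fun k => congrFun hcm k
    have hc0 : c ≠ 0 := fun h0 => by
      have := hk o
      rw [h0, zero_mul] at this
      exact div_ne_zero (hh.apply_ne_zero m o) (hh.apply_ne_zero o o) this
    refine ⟨m, funext fun k => Circle.ext ?_⟩
    simp only [f, Pi.div_apply, Circle.coe_div, hH]
    rw [hk, hk]
    have := hh.apply_ne_zero
    field_simp [this i k, this i o, this j o, this o k, this o o]
  let G : Subgroup (ι → Circle) := Subgroup.ofDiv (Set.range f) ⟨f o, o, rfl⟩ (by
    rintro _ ⟨j, rfl⟩ _ ⟨i, rfl⟩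
    obtain ⟨m, hm⟩ := hdiv i j
    exact ⟨m, by rw [hm, div_eq_mul_inv]⟩)
  let e : ι ≃ G := Equiv.ofInjective f hrow
  have he : ∀ i, ((e i : G) : ι → Circle) = f i := fun i => rfl
  have : Finite G := Finite.of_equiv ι e
  obtain ⟨n, d, D, hD⟩ := exists_equiv_pi_zmod G
  have hD1 : D.symm 0 = 1 := by
    rw [Equiv.symm_apply_eq]
    have := hD 1 1
    rwa [mul_one, left_eq_add, eq_comm] at this
  have hDadd : ∀ x y, D.symm (x + y) = D.symm x * D.symm y := fun x y => by
    rw [Equiv.symm_apply_eq, hD, Equiv.apply_symm_apply, Equiv.apply_symm_apply]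
  -- Column `k` is evaluation at `k`, a character of the group `G` of normalized rows.
  let ψ : ι → AddChar (∀ s, ZMod (d s)) ℂ := fun k =>
    { toFun := fun x => (((D.symm x : G) : ι → Circle) k : ℂ)
      map_zero_eq_one' := by simp [hD1]
      map_add_eq_mul' := fun x y => by simp [hDadd] }
  let σ : ι ≃ ∀ s, ZMod (d s) := e.trans D
  have hψ : ∀ i k, ψ k (σ i) = f i k := fun i k => by
    change (((D.symm (D (e i)) : G) : ι → Circle) k : ℂ) = _
    rw [Equiv.symm_apply_apply, he]
  let χ := Equiv.ofBijective _ (fourierChar_bijective d)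
  have hτ : Function.Injective fun k => χ.symm (ψ k) := fun k l hkl =>
    hcol k l fun i => Circle.ext (by rw [← hψ, ← hψ, χ.symm.injective hkl])
  -- The columns are distinct characters, as many as the elements of `G`, so every character occurs
  -- exactly once.
  let τ : ι ≃ ∀ s, ZMod (d s) := Equiv.ofBijective _
    ((Fintype.bijective_iff_injective_and_card _).mpr ⟨hτ, Fintype.card_congr σ⟩)
  refine ⟨n, d, σ, τ, fun i => H i o / H o o, fun k => H o k, fun i k => ?_⟩
  have hχ : fourierTensor d (σ i) (τ k) = f i k := by
    rw [← hψ]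
    exact DFunLike.congr_fun (χ.apply_symm_apply (ψ k)) (σ i)
  rw [hχ, ← hf]

end Characters

end

theorem mainTheorem10 :
    -- the Fourier matrix gives `C(ℤ/n)`
    (∀ (n : ℕ) [NeZero n],
      ∃ φ : HadamardAlgebra (isHadamard_fourierMatrix n) ≃⋆ₐ[ℂ] C(ZMod n, ℂ),
        ∀ i j, φ (HadamardAlgebra.u (isHadamard_fourierMatrix n) i j) = cyclicMagic i j) ∧
    -- tensor products of Hadamard matrices give tensor products of algebras
    (∀ (ι : Type*) [Fintype ι] [DecidableEq ι] [Nonempty ι]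
      (κ : Type*) [Fintype κ] [DecidableEq κ] [Nonempty κ]
      (h' : Matrix ι ι ℂ) (h'' : Matrix κ κ ℂ) (hh' : h'.IsHadamard) (hh'' : h''.IsHadamard),
      ∃ φ : HadamardAlgebra (hh'.kronecker hh'') ≃⋆ₐ[ℂ]
          MaxTensor (HadamardAlgebra hh') (HadamardAlgebra hh''),
        ∀ i a j b, φ (HadamardAlgebra.u (hh'.kronecker hh'') (i, a) (j, b)) =
          MaxTensor.tmul (HadamardAlgebra.u hh' i j) (HadamardAlgebra.u hh'' a b)) ∧
    -- commutativity characterizes the tensor products of Fourier matrices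
    (∀ (ι : Type*) [Fintype ι] [DecidableEq ι] [Nonempty ι]
      (h : Matrix ι ι ℂ) (hh : h.IsHadamard),
      (∀ x y : HadamardAlgebra hh, x * y = y * x) ↔
        ∃ (k : ℕ) (d : Fin k → ℕ+), HadamardEquivalent h (fourierTensor d)) := by
  refine ⟨fun n _ => exists_hadamardAlgebra_fourierMatrix_equiv n,
    fun ι _ _ _ κ _ _ _ h' h'' hh' hh'' => exists_hadamardAlgebra_kronecker_equiv hh' hh'',
    fun ι _ _ _ h hh => ⟨fun hc => hadamardEquivalent_of_commute_lineProjection hh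
      (commute_lineProjection_of_mul_comm hh hc), ?_⟩⟩
  rintro ⟨k, d, he⟩
  exact mul_comm_of_commute_lineProjection hh (commute_lineProjection_of_hadamardEquivalent hh he)
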